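/- **Theorem 4.2.** Let $(n_k)$, $(p_k)$, $(M_k)$ be sequences of integers with $n_k=p_kM_k$, $M_k\ge 1$ and $p_k\to\infty$; write $n,p,M$ for $n_k,p_k,M_k$. Consider the Poisson block model with parameter $\upsilon=(\upsilon_1,\dots,\upsilon_p)$: the observations $Y_1,\dots,Y_n$ are independent, and $Y_i\sim\mathrm{Poisson}(\upsilon_j)$ for $i\in\mathcal I_j=\{i:\lceil i/M\rceil=j\}$, $j=1,\dots,p$. The prior makes $\upsilon_1,\dots,\upsilon_p$ i.i.d. exponential with mean $\mu=\mu_k>0$ (rate $1/\mu_k$), where $\mu_k$ may depend on $k$ and satisfies $\mu_k\sqrt{n/p}\to\infty$ (in particular $\mu_k$ may be any fixed positive constant). The posterior given $Y=(Y_1,\dots,Y_n)$ is the normalized product of likelihood and prior. The target is $\theta=\frac1p\sum_{j=1}^p\log\upsilon_j$. Let $Z_j=\sum_{i\in\mathcal I_j}Y_i$, let $\tilde\upsilon_j=Z_j/M$ be the maximum likelihood estimator, and let $\tilde\theta_n=\frac1p\sum_{j=1}^p\log\tilde\upsilon_j$ be the profile maximum likelihood estimator of $\theta$ (on the event that some $Z_j=0$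 its value is immaterial; use $\log 0:=0$). Suppose that the data are in fact generated with $Y_i\sim\mathrm{Poisson}(1/p)$, independently, for all $i=1,\dots,n$. Then, as $k\to\infty$, the following holds for the posterior law of $\sqrt{n/p}\,(\theta-\tilde\theta_n)$ given $Y$, with convergence in probability under the law of the data: 1. If $p^3/n\to0$, then $$\sqrt{n/p}\,(\theta-\tilde\theta_n)\,\big|\,Y\ \xrightarrow{\,w\,}\ \mathcal N(0,1).$$ 2. If $p^3/n=\beta^2$ for all $k$, with a constant $\beta>0$, then $$\sqrt{n/p}\,(\theta-\tilde\theta_n)\,\big|\,Y\ \xrightarrow{\,w\,}\ \mathcal N(\beta/2,1).$$ 3. If $p^3/n\to\infty$ but $p^4/n^{3/2}\to0$, then $$\sqrt{n/p}\,(\theta-\tilde\theta_n)\,\big|\,Y\ \xrightarrow{\,w\,}\ +\infty.$$ Here $Q_k\xrightarrow{w}\nu$ for random probability measures $Q_k$ on $\mathbb R$ means that $\int f\,dQ_k\to\int f\,d\nu$ in probability for every bounded continuous $f:\mathbb R\to\mathbb R$, and $Q_k\xrightarrow{w}+\infty$ means that $Q_k((K,\infty))\to1$ in probability for every $K\in\mathbb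 R$. -/

import Mathlib

open MeasureTheory ProbabilityTheory Filter Topology

namespace PoissonBvM

noncomputable section

/-- The block model with `p` consecutive blocks of `M` observations each: the `Y i`,
`i = 0, …, p * M - 1`, are independent and `Y i ∼ Poisson (υ j)` for `i` in block `j`, that is
for `⌊i / M⌋ = j` with indices counted from zero. -/
def model (p M : ℕ) (υ : Fin p → ℝ) : Measure (Fin (p * M) → ℕ) :=
  Measure.pi fun i => poissonMeasure (υ (Fin.divNat i)).toNNReal

/-- The law of the data: every intensity equals `1 / p`. -/
def trueLaw (p M : ℕ) : Measure (Fin (p * M) → ℕ) :=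
  model p M fun _ => 1 / (p : ℝ)

/-- The prior: the intensities `υ j` are i.i.d. exponential with mean `μ` (rate `μ⁻¹`). -/
def prior (p : ℕ) (μ : ℝ) : Measure (Fin p → ℝ) :=
  Measure.pi fun _ => expMeasure μ⁻¹

/-- The likelihood of the observed vector `y`. -/
def likelihood (p M : ℕ) (υ : Fin p → ℝ) (y : Fin (p * M) → ℕ) : ENNReal :=
  model p M υ {y}

/-- The posterior: the normalization of likelihood times prior. -/
def posterior (p M : ℕ) (μ : ℝ) (y : Fin (p * M) → ℕ) : Measure (Fin p → ℝ) :=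
  (∫⁻ υ, likelihood p M υ y ∂(prior p μ))⁻¹ •
    (prior p μ).withDensity fun υ => likelihood p M υ y

/-- The target parameter: the mean of the log-intensities. -/
def target (p : ℕ) (υ : Fin p → ℝ) : ℝ :=
  (1 / (p : ℝ)) * ∑ j, Real.log (υ j)

/-- The sum `Z j` of the observations in block `j`. -/
def blockSum (p M : ℕ) (y : Fin (p * M) → ℕ) (j : Fin p) : ℕ :=
  ∑ i with Fin.divNat i = j, y i

/-- The maximum likelihood estimator `Z j / M` of the intensities. -/
def mle (p M : ℕ) (y : Fin (p * M) → ℕ) (j : Fin p) : ℝ :=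
  (blockSum p M y j : ℝ) / (M : ℝ)

/-- The profile maximum likelihood estimator of the target. On the event that some `Z j` vanishes
it has no meaning in the mathematics; there the convention `Real.log 0 = 0` is in force. -/
def profileMLE (p M : ℕ) (y : Fin (p * M) → ℕ) : ℝ :=
  target p (mle p M y)

/-- The posterior law, given the data `y`, of `√(n / p) * (θ - θ̃)` where `n = p * M`. -/
def scaledPosterior (p M : ℕ) (μ : ℝ) (y : Fin (p * M) → ℕ) : Measure ℝ :=
  (posterior p M μ y).map fun υ =>
    Real.sqrt (((p * M : ℕ) : ℝ) / (p : ℝ)) * (target p υ - profileMLE p M y)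

/-- The random measures `Q k`, defined on the probability spaces `(Ω k, P k)`, converge weakly to
the deterministic measure `ν`, in probability. -/
def TendstoWeaklyInProb {Ω : ℕ → Type} [∀ k, MeasurableSpace (Ω k)] (P : ∀ k, Measure (Ω k))
    (Q : ∀ k, Ω k → Measure ℝ) (ν : Measure ℝ) : Prop :=
  ∀ f : BoundedContinuousFunction ℝ ℝ, ∀ ε : ℝ, 0 < ε →
    Tendsto (fun k => P k {ω | ε ≤ |(∫ x, f x ∂(Q k ω)) - ∫ x, f x ∂ν|}) atTop (𝓝 0)

/-- The random measures `Q k` escape to `+∞` in probability: the mass of every half-line `(K, ∞)`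
tends to one, in probability. -/
def TendstoTopInProb {Ω : ℕ → Type} [∀ k, MeasurableSpace (Ω k)] (P : ∀ k, Measure (Ω k))
    (Q : ∀ k, Ω k → Measure ℝ) : Prop :=
  ∀ K ε : ℝ, 0 < ε →
    Tendsto (fun k => P k {ω | ε ≤ |(Q k ω).real (Set.Ioi K) - 1|}) atTop (𝓝 0)

end

end PoissonBvM

/-!
The exponential prior is a Gamma distribution, hence conjugate to the Poisson likelihood, so under
the posterior the intensities are independent Gamma variables of shapes `Z j + 1`
and common rate `M + 1 / μ` (`posterior_eq_pi_gammaMeasure`). The characteristic function of the scaled posterior is therefore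
a product over the blocks of quotients `Γ(Z + 1 + i s) / (Γ(Z + 1) Z ^ (i s))`, with
`s = t √M / p`, times a phase caused by the rate `1 / μ` of the prior
(`charFun_scaledPosterior`).

The quotient equals `exp ((i s - s ^ 2) / (2 Z))` up to an error of order
`(|s| + |s| ^ 3) / Z ^ 2` (`norm_gammaRatioError_sub_one_le`). This follows from Euler's product
alone: the quotient tends to one as `Z → ∞`, and consecutive values of its ratio to the
approximation differ by a factor whose logarithm is summable.

Every `Z j` is concentrated around `M / p`. By Chernoff's inequality all of them are
within a factor `1 ± (M / p) ^ (-1 / 4)` of it, with probability tending to one as soon as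
`p / (M / p) ^ (3 / 2) → 0` (`tendsto_trueLaw_compl_goodEvent`). On that event the `p` errors in
the approximation add up to something negligible, the factors `exp (-s ^ 2 / (2 Z j))` multiply to
`exp (-t ^ 2 / 2)` in the limit, and the factors `exp (i s / (2 Z j))` to `exp (i t m)`, where `m`
is asymptotic to `√(p ^ 3 / n) / 2`. The contribution of the prior to the centring is at most
`1 / (μ √M)`, which vanishes. Hence the posterior centred at `m` is asymptotically standard normal
(`tendsto_charFun_scaledPosterior`), and the three regimes are those in which `m` tends to `0`, to
`β / 2` and to `+∞`. The quantity `p / (M / p) ^ (3 / 2)` is `p ^ 4 / n ^ (3 / 2)`; it tends to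
zero by assumption in the last regime and automatically in the other two
(`tendsto_div_sqrt_cube`).
-/

namespace PoissonBvM

noncomputable section

/-! ### Quotients of Gamma functions along a vertical line -/

/-- The quotient `Γ(z + 1 + i s) / (Γ(z + 1) z ^ (i s))`: the characteristic function at `s` of
`log (G / z)` for a Gamma variable `G` of shape `z + 1` and rate one. Only `z > 0` is meaningful. -/
def gammaRatio (z : ℕ) (s : ℝ) : ℂ :=
  Complex.Gamma (z + 1 + s * Complex.I) / Complex.Gamma (z + 1) *
    Complex.exp (-(s * Real.log z * Complex.I))

/-- `gammaRatio z s` divided by its approximation `exp ((i s - s ^ 2) / (2 z))`. -/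
def gammaRatioError (z : ℕ) (s : ℝ) : ℂ :=
  gammaRatio z s * Complex.exp (-((s * Complex.I - s ^ 2) / (2 * z)))

/-- The logarithm of the quotient of two consecutive values of `gammaRatioError`. -/
def gammaRatioStep (m : ℕ) (s : ℝ) : ℂ :=
  Complex.log (1 + s * Complex.I / (m + 1)) - s * Complex.I * Real.log ((m + 1) / m) +
    (s * Complex.I - s ^ 2) / (2 * m * (m + 1))

lemma gammaRatioError_succ {m : ℕ} (hm : 0 < m) (s : ℝ) :
    gammaRatioError (m + 1) s = gammaRatioError m s * Complex.exp (gammaRatioStep m s) := by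
  have hm' : (0 : ℝ) < m := by exact_mod_cast hm
  have hmC : (m : ℂ) ≠ 0 := by exact_mod_cast hm.ne'
  have hm1C : (m : ℂ) + 1 ≠ 0 := by exact_mod_cast m.succ_ne_zero
  have h1 : (m : ℂ) + 1 + s * Complex.I ≠ 0 := by
    intro h
    have := congrArg Complex.re h
    simp at this
    linarith
  have h2 : (1 : ℂ) + s * Complex.I / (m + 1) ≠ 0 := by
    intro h
    apply h1
    field_simp at h
    linear_combination h
  have hG : Complex.Gamma (m + 1) ≠ 0 := by
    rw [Complex.Gamma_nat_eq_factorial]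
    exact_mod_cast m.factorial_ne_zero
  have hG1 : Complex.Gamma ((m : ℂ) + 1 + 1) = (m + 1) * Complex.Gamma (m + 1) :=
    Complex.Gamma_add_one _ hm1C
  have hG2 : Complex.Gamma ((m : ℂ) + 1 + 1 + s * Complex.I) =
      (m + 1 + s * Complex.I) * Complex.Gamma (m + 1 + s * Complex.I) := by
    rw [← Complex.Gamma_add_one _ h1]
    congr 1
    ring
  rw [gammaRatioStep, Real.log_div (by positivity) (by positivity), gammaRatioError,
    gammaRatioError, gammaRatio, gammaRatio]
  rw [Complex.exp_add, Complex.exp_sub, Complex.exp_log h2]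
  simp only [Nat.cast_succ, Complex.ofReal_sub]
  rw [hG1, hG2]
  have e1 : ∀ a b : ℂ, Complex.exp (-a) = Complex.exp (-b) / Complex.exp (a - b) := by
    intro a b
    rw [← Complex.exp_sub]
    congr 1
    ring
  rw [e1 (s * (Real.log (m + 1) : ℂ) * Complex.I) (s * (Real.log m : ℂ) * Complex.I),
    e1 ((s * Complex.I - s ^ 2) / (2 * (m + 1))) ((s * Complex.I - s ^ 2) / (2 * m))]
  have e2 : (s * Complex.I - s ^ 2) / (2 * ((m : ℂ) + 1)) - (s * Complex.I - s ^ 2) / (2 * m) =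
      -((s * Complex.I - s ^ 2) / (2 * m * (m + 1))) := by
    field_simp
    ring
  have e3 : s * (Real.log (m + 1) : ℂ) * Complex.I - s * (Real.log m : ℂ) * Complex.I =
      s * Complex.I * ((Real.log (m + 1) : ℂ) - Real.log m) := by ring
  rw [e2, e3, Complex.exp_neg ((s * Complex.I - s ^ 2) / (2 * m * (m + 1)))]
  have := Complex.exp_ne_zero ((s * Complex.I - s ^ 2) / (2 * m * (m + 1)))
  have := Complex.exp_ne_zero (s * Complex.I * ((Real.log (m + 1) : ℂ) - Real.log m))
  field_simp

/-- The first and second order terms of the two logarithms cancel against the correction up to a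
term of third order. -/
lemma norm_gammaRatioStep_le {m : ℕ} (hm : 0 < m) {s : ℝ} (hs : |s| ≤ m / 2) :
    ‖gammaRatioStep m s‖ ≤ 3 * (|s| + |s| ^ 3) / (m * (m + 1) ^ 2) := by
  have hm' : (1 : ℝ) ≤ m := by exact_mod_cast hm
  have hmC : (m : ℂ) ≠ 0 := by exact_mod_cast hm.ne'
  have hm1C : (m : ℂ) + 1 ≠ 0 := by exact_mod_cast m.succ_ne_zero
  set w : ℂ := s * Complex.I / (m + 1) with hw
  have hnorm : ‖(m : ℂ) + 1‖ = m + 1 := by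
    have : ((m + 1 : ℕ) : ℂ) = (m : ℂ) + 1 := by push_cast; rfl
    rw [← this, Complex.norm_natCast]
    push_cast
    rfl
  have hwn : ‖w‖ = |s| / (m + 1) := by
    rw [hw, norm_div, hnorm]
    simp
  have hw2 : ‖w‖ ≤ 1 / 2 := by
    rw [hwn, div_le_iff₀ (by positivity)]
    linarith
  have hlog1 : ‖Complex.log (1 + w) - w + w ^ 2 / 2‖ ≤ |s| ^ 3 / (m + 1) ^ 3 := by
    have h := Complex.norm_log_sub_logTaylor_le 2 (z := w) (by linarith)
    have h3 : Complex.log (1 + w) - w + w ^ 2 / 2 =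
        Complex.log (1 + w) - Complex.logTaylor (2 + 1) w := by
      simp [Complex.logTaylor, Finset.sum_range_succ]
      ring
    rw [h3]
    refine h.trans ?_
    have h4 : (1 - ‖w‖)⁻¹ ≤ 2 := by
      rw [inv_le_comm₀ (by linarith) (by norm_num)]
      linarith
    calc ‖w‖ ^ (2 + 1) * (1 - ‖w‖)⁻¹ / ((2 : ℕ) + 1) ≤ ‖w‖ ^ 3 * 2 / (2 + 1) := by
          push_cast
          gcongr
      _ ≤ ‖w‖ ^ 3 := by nlinarith [pow_nonneg (norm_nonneg w) 3]
      _ = _ := by rw [hwn, div_pow]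
  have hlog2 : |Real.log ((m + 1) / m) - 1 / (m + 1) - 1 / (2 * (m + 1) ^ 2)| ≤
      2 / ((m : ℝ) + 1) ^ 3 := by
    have hx1 : (1 : ℝ) / (m + 1) ≤ 1 / 2 := by
      apply one_div_le_one_div_of_le <;> linarith
    have hx0 : (0 : ℝ) < 1 / (m + 1) := by positivity
    have h := Real.abs_log_sub_add_sum_range_le (x := 1 / ((m : ℝ) + 1))
      (by rw [abs_of_pos hx0]; linarith) 2
    have h5 : Real.log ((m + 1) / m) = -Real.log (1 - 1 / (m + 1)) := by
      rw [← Real.log_inv, one_sub_div (by positivity), add_sub_cancel_right, inv_div]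
    rw [← abs_neg] at h
    have h6 : Real.log ((m + 1) / m) - 1 / (m + 1) - 1 / (2 * (m + 1) ^ 2) =
      -(∑ i ∈ Finset.range 2, (1 / ((m : ℝ) + 1)) ^ (i + 1) / (i + 1) +
        Real.log (1 - 1 / (m + 1))) := by
      rw [h5]
      simp [Finset.sum_range_succ]
      ring
    rw [h6]
    refine h.trans ?_
    rw [abs_of_pos hx0]
    calc (1 / ((m : ℝ) + 1)) ^ (2 + 1) / (1 - 1 / (m + 1))
        ≤ (1 / ((m : ℝ) + 1)) ^ (2 + 1) / (1 / 2) := by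
          gcongr
          linarith
      _ = _ := by
          rw [div_pow]
          ring
  have hdecomp : gammaRatioStep m s = (Complex.log (1 + w) - w + w ^ 2 / 2)
      - s * Complex.I * ((Real.log ((m + 1) / m) - 1 / (m + 1) - 1 / (2 * (m + 1) ^ 2) : ℝ) : ℂ)
      + (s * Complex.I - s ^ 2) / (2 * m * (m + 1) ^ 2) := by
    rw [gammaRatioStep, ← hw]
    push_cast
    rw [hw]
    have hI : Complex.I ^ 2 = -1 := Complex.I_sq
    field_simp
    ring_nf
    rw [hI]
    ring
  have hn3 : ‖(s * Complex.I - s ^ 2 : ℂ) / (2 * m * (m + 1) ^ 2)‖ ≤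
      (|s| + |s| ^ 2) / (2 * m * (m + 1) ^ 2) := by
    rw [norm_div]
    have : ‖(2 * m * (m + 1) ^ 2 : ℂ)‖ = 2 * m * (m + 1) ^ 2 := by
      rw [norm_mul, norm_pow, hnorm, norm_mul]
      simp
    rw [this]
    gcongr
    refine (norm_sub_le _ _).trans ?_
    simp
  have hn2 : ‖s * Complex.I *
      ((Real.log ((m + 1) / m) - 1 / (m + 1) - 1 / (2 * (m + 1) ^ 2) : ℝ) : ℂ)‖ ≤
      |s| * (2 / ((m : ℝ) + 1) ^ 3) := by
    rw [norm_mul, norm_mul, Complex.norm_I, Complex.norm_real, Complex.norm_real, mul_one,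
      Real.norm_eq_abs, Real.norm_eq_abs]
    gcongr
  rw [hdecomp]
  refine (norm_add_le _ _).trans ?_
  refine (add_le_add (norm_sub_le _ _) le_rfl).trans ?_
  refine (add_le_add (add_le_add hlog1 hn2) hn3).trans ?_
  have hcube : 1 / ((m : ℝ) + 1) ^ 3 ≤ 1 / (m * (m + 1) ^ 2) := by
    apply one_div_le_one_div_of_le (by positivity)
    nlinarith [sq_nonneg ((m : ℝ) + 1)]
  have ha := abs_nonneg s
  have hq : |s| ^ 2 ≤ |s| + |s| ^ 3 := by
    nlinarith [mul_nonneg ha (sq_nonneg (|s| - 1))]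
  have hpos : (0 : ℝ) ≤ 1 / (m * (m + 1) ^ 2) := by positivity
  calc |s| ^ 3 / (m + 1) ^ 3 + |s| * (2 / (m + 1) ^ 3) + (|s| + |s| ^ 2) / (2 * m * (m + 1) ^ 2)
      = (|s| ^ 3 + 2 * |s|) * (1 / (m + 1) ^ 3) +
        ((|s| + |s| ^ 2) / 2) * (1 / (m * (m + 1) ^ 2)) := by
        field_simp
    _ ≤ (|s| ^ 3 + 2 * |s|) * (1 / (m * (m + 1) ^ 2)) +
        ((|s| + |s| ^ 2) / 2) * (1 / (m * (m + 1) ^ 2)) := by gcongr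
    _ = (|s| ^ 3 + 2 * |s| + (|s| + |s| ^ 2) / 2) * (1 / (m * (m + 1) ^ 2)) := by ring
    _ ≤ (3 * (|s| + |s| ^ 3)) * (1 / (m * (m + 1) ^ 2)) := by
        gcongr
        nlinarith [pow_nonneg ha 3]
    _ = _ := by ring

lemma gammaRatioError_add {z : ℕ} (hz : 0 < z) (s : ℝ) (N : ℕ) :
    gammaRatioError (z + N) s =
      gammaRatioError z s * Complex.exp (∑ i ∈ Finset.range N, gammaRatioStep (z + i) s) := by
  induction N with
  | zero => simp
  | succ N ih =>
    rw [← add_assoc, gammaRatioError_succ (by omega), ih, Finset.sum_range_succ, Complex.exp_add,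
      mul_assoc]

lemma norm_sum_gammaRatioStep_le {z : ℕ} (hz : 0 < z) {s : ℝ} (hs : |s| ≤ z / 2) (N : ℕ) :
    ‖∑ i ∈ Finset.range N, gammaRatioStep (z + i) s‖ ≤ 3 * (|s| + |s| ^ 3) / z ^ 2 := by
  have hz' : (0 : ℝ) < z := by exact_mod_cast hz
  have key : ‖∑ i ∈ Finset.range N, gammaRatioStep (z + i) s‖ ≤
      3 * (|s| + |s| ^ 3) / z * (1 / z - 1 / (z + N)) := by
    induction N with
    | zero => simp
    | succ N ih =>
      rw [Finset.sum_range_succ]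
      refine (norm_add_le _ _).trans ?_
      have h1 := norm_gammaRatioStep_le (m := z + N) (by omega) (s := s) (hs.trans (by
        push_cast
        have : (0 : ℝ) ≤ N := by positivity
        linarith))
      push_cast at h1 ⊢
      have h2 : 3 * (|s| + |s| ^ 3) / ((z + N : ℝ) * (z + N + 1) ^ 2) ≤
          3 * (|s| + |s| ^ 3) / z * (1 / (z + N) - 1 / (z + (N + 1))) := by
        have h3 : (1 / (z + N) - 1 / (z + (N + 1)) : ℝ) = 1 / ((z + N) * (z + N + 1)) := by
          field_simp
          ring
        rw [h3, div_mul_div_comm, mul_one]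
        apply div_le_div_of_nonneg_left (by positivity) (by positivity)
        have : (z : ℝ) ≤ z + N + 1 := by
          have : (0 : ℝ) ≤ N := by positivity
          linarith
        calc (z : ℝ) * ((z + N) * (z + N + 1)) ≤ (z + N + 1) * ((z + N) * (z + N + 1)) := by gcongr
          _ = _ := by ring
      linarith
  refine key.trans ?_
  calc 3 * (|s| + |s| ^ 3) / z * (1 / z - 1 / (z + N)) ≤ 3 * (|s| + |s| ^ 3) / z * (1 / z) := by
        gcongr
        have : (0 : ℝ) ≤ 1 / (z + N) := by positivity
        linarith
    _ = _ := by ring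

lemma Gamma_eq_prod_mul {σ : ℂ} (hσ : 0 < σ.re) (N : ℕ) :
    Complex.Gamma (σ + N) = (∏ j ∈ Finset.range N, (σ + j)) * Complex.Gamma σ := by
  induction N with
  | zero => simp
  | succ N ih =>
    have h : σ + N ≠ 0 := by
      intro h
      have := congrArg Complex.re h
      simp at this
      have : (0 : ℝ) ≤ N := by positivity
      linarith
    rw [Finset.prod_range_succ, Nat.cast_succ, ← add_assoc, Complex.Gamma_add_one _ h, ih]
    ring

/-- Euler's product for the Gamma function. -/
lemma tendsto_gammaRatio (s : ℝ) : Tendsto (fun N => gammaRatio N s) atTop (𝓝 1) := by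
  set σ : ℂ := 1 + s * Complex.I with hσ
  have hre : 0 < σ.re := by simp [hσ]
  have hΓ : Complex.Gamma σ ≠ 0 := Complex.Gamma_ne_zero_of_re_pos hre
  have h1 := (Complex.GammaSeq_tendsto_Gamma σ)
  have h2 : Tendsto (fun N : ℕ => (Complex.GammaSeq σ N)⁻¹ * Complex.Gamma σ) atTop (𝓝 1) := by
    have := (h1.inv₀ hΓ).mul_const (Complex.Gamma σ)
    rwa [inv_mul_cancel₀ hΓ] at this
  have h3 : Tendsto (fun N : ℕ => (1 + σ * (N : ℂ)⁻¹)⁻¹) atTop (𝓝 1) := by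
    have h4 : Tendsto (fun N : ℕ => (N : ℂ)⁻¹) atTop (𝓝 0) := tendsto_inv_atTop_nhds_zero_nat
    have h5 := ((h4.const_mul σ).const_add 1).inv₀ (by simp)
    simpa using h5
  have h6 := h2.mul h3
  rw [mul_one] at h6
  refine h6.congr' ?_
  filter_upwards [eventually_gt_atTop 0] with N hN
  have hNC : (N : ℂ) ≠ 0 := by exact_mod_cast hN.ne'
  have hNR : (0 : ℝ) < N := by exact_mod_cast hN
  have hne : σ + N ≠ 0 := by
    intro h
    have := congrArg Complex.re h
    simp at this
    linarith
  have hprod : ∏ j ∈ Finset.range N, (σ + j) ≠ 0 := by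
    refine Finset.prod_ne_zero_iff.2 fun j _ h => ?_
    have := congrArg Complex.re h
    simp at this
    have : (0 : ℝ) ≤ j := by positivity
    linarith
  have hpow : (N : ℂ) ^ σ = N * Complex.exp (s * Real.log N * Complex.I) := by
    rw [hσ, Complex.cpow_add _ _ hNC, Complex.cpow_one, Complex.cpow_def_of_ne_zero hNC,
      ← Complex.natCast_log]
    congr 2
    push_cast
    ring
  have hfac : ((N.factorial : ℕ) : ℂ) ≠ 0 := by exact_mod_cast N.factorial_ne_zero
  have hone : (1 : ℂ) + σ * (N : ℂ)⁻¹ = (σ + N) / N := by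
    field_simp
    ring
  rw [Complex.GammaSeq, gammaRatio, Finset.prod_range_succ, hpow, hone,
    Complex.Gamma_nat_eq_factorial, Complex.exp_neg]
  have : (N : ℂ) + 1 + s * Complex.I = σ + N := by rw [hσ]; ring
  rw [this, Gamma_eq_prod_mul hre]
  have := Complex.exp_ne_zero (s * Real.log N * Complex.I)
  field_simp

/-- A form of Stirling's formula along a vertical line, with an explicit remainder: for a Gamma
variable `G` of shape `z + 1` and rate one, the characteristic function of
`log (G / z)` is close to that of a normal variable with mean `1 / (2 z)` and variance `1 / z`. -/
lemma norm_gammaRatioError_sub_one_le {z : ℕ} (hz : 0 < z) {s : ℝ} (hs : |s| ≤ z / 2) :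
    ‖gammaRatioError z s - 1‖ ≤
      3 * (|s| + |s| ^ 3) / z ^ 2 * Real.exp (3 * (|s| + |s| ^ 3) / z ^ 2) := by
  set B := 3 * (|s| + |s| ^ 3) / (z : ℝ) ^ 2 with hB
  have hB0 : 0 ≤ B := by positivity
  have hlim0 : Tendsto (fun N => gammaRatioError N s) atTop (𝓝 1) := by
    have h4 : Tendsto (fun N : ℕ => (N : ℂ)⁻¹) atTop (𝓝 0) := tendsto_inv_atTop_nhds_zero_nat
    have h5 := (h4.const_mul (-((s * Complex.I - s ^ 2) / 2))).cexp
    rw [mul_zero, Complex.exp_zero] at h5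
    have h6 := (tendsto_gammaRatio s).mul h5
    rw [mul_one] at h6
    refine h6.congr fun N => ?_
    rw [gammaRatioError]
    congr 2
    rw [neg_mul, ← div_eq_mul_inv, div_div]
  have hlim : Tendsto (fun N => gammaRatioError (z + N) s) atTop (𝓝 1) := by
    have := hlim0.comp (tendsto_add_atTop_nat z)
    refine this.congr fun N => ?_
    rw [Function.comp, add_comm]
  have hbound : ∀ N, ‖gammaRatioError z s - gammaRatioError (z + N) s‖ ≤
      ‖gammaRatioError (z + N) s‖ * (B * Real.exp B) := by
    intro N
    set S := ∑ i ∈ Finset.range N, gammaRatioStep (z + i) s with hS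
    have hSB : ‖S‖ ≤ B := norm_sum_gammaRatioStep_le hz hs N
    have h1 : gammaRatioError z s - gammaRatioError (z + N) s =
        gammaRatioError (z + N) s * (Complex.exp (-S) - 1) := by
      rw [gammaRatioError_add hz, mul_sub, mul_assoc, ← Complex.exp_add]
      simp [hS]
    rw [h1, norm_mul]
    gcongr
    have h2 := Complex.norm_exp_sub_sum_le_norm_mul_exp (-S) 1
    simp only [Finset.sum_range_one, pow_zero, Nat.factorial_zero, Nat.cast_one, div_one, pow_one,
      norm_neg] at h2
    refine h2.trans ?_
    gcongr
  have hL := (hlim.const_sub (gammaRatioError z s)).norm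
  have hR := hlim.norm.mul_const (B * Real.exp B)
  rw [norm_one, one_mul] at hR
  exact le_of_tendsto_of_tendsto' hL hR hbound

/-! ### The posterior and its characteristic function -/

lemma pi_withDensity_prod {ι : Type*} [Fintype ι] (ν ρ : ι → Measure ℝ)
    [∀ i, IsProbabilityMeasure (ν i)] [∀ i, IsProbabilityMeasure (ρ i)]
    (l : ι → ℝ → ENNReal) (hl : ∀ i, Measurable (l i)) (c : ι → NNReal)
    (h : ∀ i, (ν i).withDensity (l i) = c i • ρ i) :
    (Measure.pi ν).withDensity (fun x => ∏ i, l i (x i)) = (∏ i, c i) • Measure.pi ρ := by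
  have h1 : Measure.pi (fun i => c i • ρ i) =
      (Measure.pi ν).withDensity (fun x => ∏ i, l i (x i)) := by
    refine Measure.pi_eq fun s hs => ?_
    rw [withDensity_apply _ (MeasurableSet.univ_pi hs),
      ← lintegral_indicator (MeasurableSet.univ_pi hs)]
    have h2 : (Set.univ.pi s).indicator (fun x : ι → ℝ => ∏ i, l i (x i)) =
        fun x => ∏ i, (s i).indicator (l i) (x i) := by
      ext x
      by_cases hx : x ∈ Set.univ.pi s
      · rw [Set.indicator_of_mem hx]
        exact Finset.prod_congr rfl fun i _ => (Set.indicator_of_mem (hx i trivial) _).symm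
      · rw [Set.indicator_of_notMem hx]
        simp only [Set.mem_pi, Set.mem_univ, true_imp_iff, not_forall] at hx
        obtain ⟨i, hi⟩ := hx
        exact (Finset.prod_eq_zero (Finset.mem_univ i) (Set.indicator_of_notMem hi _)).symm
    have hm : ∀ i, Measurable ((s i).indicator (l i)) := fun i => (hl i).indicator (hs i)
    rw [h2]
    refine (lintegral_prod_eq_prod_lintegral_of_indepFun Finset.univ
      (fun i (x : ι → ℝ) => (s i).indicator (l i) (x i))
      (iIndepFun_pi fun i => (hm i).aemeasurable)
      (fun i => (hm i).comp (measurable_pi_apply i))).trans ?_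
    refine Finset.prod_congr rfl fun i _ => ?_
    rw [← h i, withDensity_apply _ (hs i), ← lintegral_indicator (hs i)]
    exact ((measurePreserving_eval ν i).lintegral_comp (hm i))
  rw [← h1]
  refine Measure.pi_eq fun s _ => ?_
  simp only [Measure.smul_apply, Measure.pi_pi, ENNReal.smul_def, smul_eq_mul,
    Finset.prod_mul_distrib, ENNReal.ofNNReal_finsetProd]

/-- The factor of the likelihood that comes from the observations in block `j`, as a function of
the intensity of that block. -/
def blockLikelihood (p M : ℕ) (y : Fin (p * M) → ℕ) (j : Fin p) (v : ℝ) : ENNReal :=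
  ∏ i with Fin.divNat i = j, poissonMeasure v.toNNReal {y i}

lemma likelihood_eq_prod (p M : ℕ) (υ : Fin p → ℝ) (y : Fin (p * M) → ℕ) :
    likelihood p M υ y = ∏ j, blockLikelihood p M y j (υ j) := by
  rw [likelihood, model, Measure.pi_singleton,
    ← Finset.prod_fiberwise Finset.univ (fun i : Fin (p * M) => Fin.divNat i)]
  refine Finset.prod_congr rfl fun j _ => Finset.prod_congr rfl fun i hi => ?_
  rw [(Finset.mem_filter.1 hi).2]

lemma card_block (p M : ℕ) (j : Fin p) :
    (Finset.univ.filter fun i : Fin (p * M) => Fin.divNat i = j).card = M := by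
  have h : (Finset.univ.filter fun i : Fin (p * M) => Fin.divNat i = j) =
      Finset.univ.map ⟨fun b : Fin M => finProdFinEquiv (j, b), fun a b hab => by simpa using hab⟩ := by
    ext i
    simp only [Finset.mem_filter, Finset.mem_univ, true_and, Finset.mem_map]
    constructor
    · rintro rfl
      exact ⟨Fin.modNat i, finProdFinEquiv.apply_symm_apply i⟩
    · rintro ⟨b, rfl⟩
      exact congrArg Prod.fst (finProdFinEquiv.symm_apply_apply (j, b))
  rw [h, Finset.card_map, Finset.card_univ, Fintype.card_fin]

lemma blockLikelihood_of_nonneg {p M : ℕ} (y : Fin (p * M) → ℕ) (j : Fin p) {v : ℝ}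
    (hv : 0 ≤ v) : blockLikelihood p M y j v =
      ENNReal.ofReal ((∏ i with Fin.divNat i = j, ((y i).factorial : ℝ))⁻¹ *
        (v ^ blockSum p M y j * Real.exp (-(M * v)))) := by
  rw [blockLikelihood]
  simp_rw [poissonMeasure_singleton]
  rw [← ENNReal.ofReal_prod_of_nonneg fun i _ => by positivity]
  congr 1
  rw [Real.coe_toNNReal v hv, Finset.prod_div_distrib, Finset.prod_mul_distrib,
    Finset.prod_const, card_block, Finset.prod_pow_eq_pow_sum, ← Real.exp_nat_mul]
  rw [← blockSum, div_eq_mul_inv, mul_neg]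
  ring

lemma measurable_blockLikelihood (p M : ℕ) (y : Fin (p * M) → ℕ) (j : Fin p) :
    Measurable (blockLikelihood p M y j) := by
  unfold blockLikelihood
  simp_rw [poissonMeasure_singleton]
  fun_prop

/-- The Gamma distributions are conjugate to the Poisson likelihood. -/
lemma exists_expMeasure_withDensity_blockLikelihood {p M : ℕ} {μ : ℝ} (hμ : 0 < μ)
    (y : Fin (p * M) → ℕ) (j : Fin p) : ∃ c : NNReal, c ≠ 0 ∧
      (expMeasure μ⁻¹).withDensity (blockLikelihood p M y j) =
        c • gammaMeasure (blockSum p M y j + 1) (M + μ⁻¹) := by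
  set Z := blockSum p M y j with hZ
  set F : ℝ := ∏ i with Fin.divNat i = j, ((y i).factorial : ℝ) with hF
  have hFpos : 0 < F := Finset.prod_pos fun i _ => by positivity
  have hr : 0 < μ⁻¹ := inv_pos.2 hμ
  have hr' : 0 < M + μ⁻¹ := by positivity
  have hΓ : 0 < Real.Gamma (Z + 1) := Real.Gamma_pos_of_pos (by positivity)
  have hpow : 0 < (M + μ⁻¹) ^ (Z + 1 : ℝ) := Real.rpow_pos_of_pos hr' _
  set c : ℝ := μ⁻¹ * F⁻¹ * Real.Gamma (Z + 1) / (M + μ⁻¹) ^ (Z + 1 : ℝ) with hc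
  have hcpos : 0 < c := by positivity
  refine ⟨c.toNNReal, by simpa using hcpos, ?_⟩
  have hmeas : Measurable (gammaPDF (Z + 1) (M + μ⁻¹)) :=
    (measurable_gammaPDFReal _ _).ennreal_ofReal
  have hmeas1 : Measurable (gammaPDF 1 μ⁻¹) :=
    (measurable_gammaPDFReal _ _).ennreal_ofReal
  rw [expMeasure, gammaMeasure, gammaMeasure,
    ← withDensity_mul _ hmeas1 (measurable_blockLikelihood p M y j),
    ENNReal.smul_def, ← withDensity_smul _ hmeas]
  congr 1
  ext v
  simp only [Pi.mul_apply, Pi.smul_apply, smul_eq_mul]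
  rcases lt_or_ge v 0 with hv | hv
  · rw [gammaPDF_of_neg hv, gammaPDF_of_neg hv, zero_mul, mul_zero]
  · have hc' : ((c.toNNReal : NNReal) : ENNReal) = ENNReal.ofReal c := rfl
    rw [gammaPDF_of_nonneg hv, gammaPDF_of_nonneg hv, blockLikelihood_of_nonneg y j hv, ← hZ, ← hF,
      hc', ← ENNReal.ofReal_mul (by positivity), ← ENNReal.ofReal_mul hcpos.le]
    congr 1
    have he : Real.exp (-((M + μ⁻¹) * v)) = Real.exp (-(M * v)) * Real.exp (-(μ⁻¹ * v)) := by
      rw [← Real.exp_add]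
      congr 1
      ring
    rw [sub_self, Real.rpow_zero, add_sub_cancel_right, Real.rpow_natCast, Real.Gamma_one,
      Real.rpow_one, hc, he]
    field_simp

lemma posterior_eq_pi_gammaMeasure {p M : ℕ} {μ : ℝ} (hμ : 0 < μ) (y : Fin (p * M) → ℕ) :
    posterior p M μ y =
      Measure.pi fun j => gammaMeasure (blockSum p M y j + 1) (M + μ⁻¹) := by
  have hr : 0 < μ⁻¹ := inv_pos.2 hμ
  choose c hc0 hc using exists_expMeasure_withDensity_blockLikelihood hμ y
  have : IsProbabilityMeasure (expMeasure μ⁻¹) := isProbabilityMeasure_expMeasure hr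
  have : ∀ j : Fin p, IsProbabilityMeasure (gammaMeasure (blockSum p M y j + 1) (M + μ⁻¹)) :=
    fun j => isProbabilityMeasure_gammaMeasure (by positivity) (by positivity)
  have h := pi_withDensity_prod (fun _ : Fin p => expMeasure μ⁻¹) _ _
    (measurable_blockLikelihood p M y) c hc
  have hmass : ∫⁻ υ, likelihood p M υ y ∂(prior p μ) = ((∏ j, c j : NNReal) : ENNReal) := by
    have h1 := congrArg (fun m => m Set.univ) h
    simp only [withDensity_apply _ MeasurableSet.univ, Measure.restrict_univ, Measure.smul_apply,
      measure_univ] at h1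
    simp_rw [likelihood_eq_prod, prior]
    rw [h1, ENNReal.smul_def, smul_eq_mul, mul_one]
  have hne : ((∏ j, c j : NNReal) : ENNReal) ≠ 0 := by
    simpa [Finset.prod_eq_zero_iff] using hc0
  rw [posterior, hmass]
  simp_rw [likelihood_eq_prod, prior]
  rw [h, ENNReal.smul_def, smul_smul, ENNReal.inv_mul_cancel hne ENNReal.coe_ne_top, one_smul]

lemma isProbabilityMeasure_posterior {p M : ℕ} {μ : ℝ} (hμ : 0 < μ) (y : Fin (p * M) → ℕ) :
    IsProbabilityMeasure (posterior p M μ y) := by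
  have hr : 0 < μ⁻¹ := inv_pos.2 hμ
  have : ∀ j : Fin p, IsProbabilityMeasure (gammaMeasure (blockSum p M y j + 1) (M + μ⁻¹)) :=
    fun j => isProbabilityMeasure_gammaMeasure (by positivity) (by positivity)
  rw [posterior_eq_pi_gammaMeasure hμ]
  infer_instance

lemma measurable_target (p : ℕ) : Measurable (target p) := by
  unfold target
  fun_prop

lemma measurable_scaledTarget (p M : ℕ) (y : Fin (p * M) → ℕ) :
    Measurable fun υ => Real.sqrt (((p * M : ℕ) : ℝ) / (p : ℝ)) *
      (target p υ - profileMLE p M y) :=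
  ((measurable_target p).sub_const _).const_mul _

lemma isProbabilityMeasure_scaledPosterior {p M : ℕ} {μ : ℝ} (hμ : 0 < μ)
    (y : Fin (p * M) → ℕ) : IsProbabilityMeasure (scaledPosterior p M μ y) := by
  have := isProbabilityMeasure_posterior hμ y
  exact Measure.isProbabilityMeasure_map (measurable_scaledTarget p M y).aemeasurable

/-- The characteristic function of the logarithm of a Gamma variable. -/
lemma integral_cexp_log_gammaMeasure {a r : ℝ} (ha : 0 < a) (hr : 0 < r) (s : ℝ) :
    ∫ v, Complex.exp (s * Real.log v * Complex.I) ∂(gammaMeasure a r) =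
      Complex.Gamma (a + s * Complex.I) / Complex.Gamma a *
        Complex.exp (-(s * Real.log r * Complex.I)) := by
  have hrC : (r : ℂ) ≠ 0 := by exact_mod_cast hr.ne'
  have h1 : gammaMeasure a r = volume.withDensity fun v => ((gammaPDFReal a r v).toNNReal : ENNReal) :=
    rfl
  rw [h1, integral_withDensity_eq_integral_smul (measurable_gammaPDFReal a r).real_toNNReal]
  have hsupp : Function.support (fun v => (gammaPDFReal a r v).toNNReal •
      Complex.exp (s * Real.log v * Complex.I)) ⊆ Set.Ici 0 := by
    intro v hv
    by_contra h
    apply hv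
    have : ¬ (0 ≤ v) := h
    simp [gammaPDFReal, this]
  rw [← setIntegral_eq_integral_of_forall_compl_eq_zero
    (fun v hv => Function.notMem_support.1 fun h => hv (hsupp h)), integral_Ici_eq_integral_Ioi]
  have h2 : ∀ v ∈ Set.Ioi (0 : ℝ), (gammaPDFReal a r v).toNNReal •
      Complex.exp (s * Real.log v * Complex.I) = ((r ^ a / Real.Gamma a : ℝ) : ℂ) *
        ((v : ℂ) ^ ((a + s * Complex.I) - 1) * Complex.exp (-(r * v))) := by
    intro v hv
    have hv' : (0 : ℝ) < v := hv
    have hvC : (v : ℂ) ≠ 0 := by exact_mod_cast hv'.ne'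
    rw [NNReal.smul_def, Real.coe_toNNReal _ (gammaPDFReal_nonneg ha hr v), gammaPDFReal,
      if_pos hv'.le, Complex.real_smul]
    have h3 : (a + s * Complex.I) - 1 = ((a - 1 : ℝ) : ℂ) + s * Complex.I := by
      push_cast
      ring
    rw [h3, Complex.cpow_add _ _ hvC, ← Complex.ofReal_cpow hv'.le,
      Complex.cpow_def_of_ne_zero hvC (s * Complex.I), ← Complex.ofReal_log hv'.le]
    have h4 : (Real.log v : ℂ) * (s * Complex.I) = s * Real.log v * Complex.I := by ring
    rw [h4]
    simp only [Complex.ofReal_mul, Complex.ofReal_exp, Complex.ofReal_neg]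
    ring
  rw [setIntegral_congr_fun measurableSet_Ioi h2, integral_const_mul,
    Complex.integral_cpow_mul_exp_neg_mul_Ioi (by simpa using ha) hr]
  have h5 : (1 / (r : ℂ)) ^ ((a : ℂ) + s * Complex.I) =
      ((r ^ a : ℝ) : ℂ)⁻¹ * Complex.exp (-(s * Real.log r * Complex.I)) := by
    rw [one_div, Complex.inv_cpow _ _ (by rw [Complex.arg_ofReal_of_nonneg hr.le]; exact Real.pi_pos.ne),
      Complex.cpow_add _ _ hrC, mul_inv, Complex.ofReal_cpow hr.le,
      Complex.cpow_def_of_ne_zero hrC (s * Complex.I), ← Complex.ofReal_log hr.le, ← Complex.exp_neg]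
    congr 3
    ring
  have h6 : ((r ^ a : ℝ) : ℂ) ≠ 0 := by exact_mod_cast (Real.rpow_pos_of_pos hr a).ne'
  have h7 : Complex.Gamma a ≠ 0 := by
    rw [Complex.Gamma_ofReal]
    exact_mod_cast (Real.Gamma_pos_of_pos ha).ne'
  rw [h5, Complex.ofReal_div, ← Complex.Gamma_ofReal]
  field_simp

lemma charFun_scaledPosterior {p M : ℕ} {μ : ℝ} (hp : 0 < p) (hM : 0 < M) (hμ : 0 < μ)
    {y : Fin (p * M) → ℕ} (hy : ∀ j, 0 < blockSum p M y j) (t : ℝ) :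
    charFun (scaledPosterior p M μ y) t =
      (∏ j, gammaRatio (blockSum p M y j) (t * Real.sqrt M / p)) *
        Complex.exp (-(t * (Real.sqrt M * Real.log (1 + 1 / (μ * M)) : ℝ) * Complex.I)) := by
  have hr : 0 < μ⁻¹ := inv_pos.2 hμ
  have hp' : (0 : ℝ) < p := by exact_mod_cast hp
  have hM' : (0 : ℝ) < M := by exact_mod_cast hM
  have : ∀ j : Fin p, IsProbabilityMeasure (gammaMeasure (blockSum p M y j + 1) (M + μ⁻¹)) :=
    fun j => isProbabilityMeasure_gammaMeasure (by positivity) (by positivity)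
  set s := t * Real.sqrt M / p with hs
  have hsqrt : Real.sqrt (((p * M : ℕ) : ℝ) / (p : ℝ)) = Real.sqrt M := by
    push_cast
    rw [mul_div_cancel_left₀ _ hp'.ne']
  rw [charFun_apply_real, scaledPosterior,
    integral_map (measurable_scaledTarget p M y).aemeasurable (by fun_prop),
    posterior_eq_pi_gammaMeasure hμ, hsqrt]
  have h1 : ∀ υ : Fin p → ℝ, Complex.exp (t * (Real.sqrt M *
      (target p υ - profileMLE p M y) : ℝ) * Complex.I) =
      ∏ j, (Complex.exp (s * Real.log (υ j) * Complex.I) *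
        Complex.exp (-(s * Real.log (mle p M y j) * Complex.I))) := by
    intro υ
    rw [Finset.prod_mul_distrib, ← Complex.exp_sum, ← Complex.exp_sum, ← Complex.exp_add]
    congr 1
    rw [profileMLE, target, target, ← mul_sub, ← Finset.sum_sub_distrib, ← Finset.sum_add_distrib,
      hs]
    push_cast
    rw [Finset.mul_sum, Finset.mul_sum, Finset.mul_sum, Finset.sum_mul]
    refine Finset.sum_congr rfl fun j _ => ?_
    field_simp
    ring
  simp_rw [h1]
  rw [integral_fintype_prod_eq_prod (fun j v => Complex.exp (s * Real.log v * Complex.I) *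
        Complex.exp (-(s * Real.log (mle p M y j) * Complex.I)))]
  have h2 : (Complex.exp (-(t * (Real.sqrt M * Real.log (1 + 1 / (μ * M)) : ℝ) * Complex.I))) =
      ∏ _j : Fin p, Complex.exp (-(s * Real.log (1 + 1 / (μ * M)) * Complex.I)) := by
    rw [Finset.prod_const, Finset.card_univ, Fintype.card_fin, ← Complex.exp_nat_mul, hs]
    congr 1
    push_cast
    have : (p : ℂ) ≠ 0 := by exact_mod_cast hp.ne'
    field_simp
  rw [h2, ← Finset.prod_mul_distrib]
  refine Finset.prod_congr rfl fun j _ => ?_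
  rw [integral_mul_const, integral_cexp_log_gammaMeasure (by positivity) (by positivity),
    gammaRatio, mul_assoc, mul_assoc (_ / _), ← Complex.exp_add, ← Complex.exp_add]
  simp only [Complex.ofReal_add, Complex.ofReal_natCast, Complex.ofReal_one]
  congr 2
  have hZ : (0 : ℝ) < blockSum p M y j := by exact_mod_cast hy j
  have h3 : (M : ℝ) + μ⁻¹ = M * (1 + 1 / (μ * M)) := by
    field_simp
  have h4 : Real.log (M + μ⁻¹) = Real.log M + Real.log (1 + 1 / (μ * M)) := by
    rw [h3, Real.log_mul (by positivity) (by positivity)]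
  rw [h4, mle, Real.log_div (by positivity) (by positivity)]
  simp only [Complex.ofReal_add, Complex.ofReal_sub]
  ring

/-! ### Concentration of the block sums -/

lemma hasSum_exp_mul_poisson (r : NNReal) (t : ℝ) :
    HasSum (fun n : ℕ => (Real.exp (-r) * r ^ n / n.factorial) • Real.exp (t * n))
      (Real.exp (r * (Real.exp t - 1))) := by
  have h := (NormedSpace.expSeries_div_hasSum_exp (r * Real.exp t : ℝ)).mul_left (Real.exp (-r))
  rw [← Real.exp_eq_exp_ℝ, ← Real.exp_add] at h
  have h1 : -(r : ℝ) + r * Real.exp t = r * (Real.exp t - 1) := by ring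
  rw [h1] at h
  convert! h using 2 with n
  rw [smul_eq_mul, mul_pow, ← Real.exp_nat_mul, mul_comm t]
  ring

lemma integrable_exp_mul_poissonMeasure (r : NNReal) (t : ℝ) :
    Integrable (fun n : ℕ => Real.exp (t * n)) (poissonMeasure r) := by
  rw [integrable_poissonMeasure_iff]
  refine (hasSum_exp_mul_poisson r t).summable.congr fun n => ?_
  rw [Real.norm_eq_abs, abs_of_pos (Real.exp_pos _), smul_eq_mul]

lemma mgf_poissonMeasure (r : NNReal) (t : ℝ) :
    mgf (fun n : ℕ => (n : ℝ)) (poissonMeasure r) t = Real.exp (r * (Real.exp t - 1)) := by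
  rw [mgf, integral_poissonMeasure]
  exact (hasSum_exp_mul_poisson r t).tsum_eq

instance (p M : ℕ) : IsProbabilityMeasure (trueLaw p M) := by
  unfold trueLaw model
  infer_instance

lemma iIndepFun_trueLaw (p M : ℕ) :
    iIndepFun (fun i (y : Fin (p * M) → ℕ) => (y i : ℝ)) (trueLaw p M) :=
  iIndepFun_pi (X := fun _ (n : ℕ) => (n : ℝ)) fun _ => by fun_prop

lemma cast_blockSum (p M : ℕ) (j : Fin p) : (fun y => (blockSum p M y j : ℝ)) =
    ∑ i with Fin.divNat i = j, fun y : Fin (p * M) → ℕ => (y i : ℝ) := by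
  ext y
  simp [blockSum, Finset.sum_apply]

lemma integrable_exp_mul_trueLaw (p M : ℕ) (i : Fin (p * M)) (t : ℝ) :
    Integrable (fun y : Fin (p * M) → ℕ => Real.exp (t * (y i : ℝ))) (trueLaw p M) :=
  (measurePreserving_eval (fun _ => poissonMeasure (1 / (p : ℝ)).toNNReal) i).integrable_comp_of_integrable
    (integrable_exp_mul_poissonMeasure _ t)

lemma integrable_exp_mul_blockSum (p M : ℕ) (j : Fin p) (t : ℝ) :
    Integrable (fun y => Real.exp (t * (blockSum p M y j : ℝ))) (trueLaw p M) := by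
  have h := (iIndepFun_trueLaw p M).integrable_exp_mul_sum (t := t)
    (s := Finset.univ.filter fun i => Fin.divNat i = j) (fun i => by fun_prop)
    (fun i _ => integrable_exp_mul_trueLaw p M i t)
  rwa [← cast_blockSum] at h

lemma mgf_blockSum (p M : ℕ) (j : Fin p) (t : ℝ) :
    mgf (fun y => (blockSum p M y j : ℝ)) (trueLaw p M) t =
      Real.exp ((M / p : ℝ) * (Real.exp t - 1)) := by
  rw [cast_blockSum, (iIndepFun_trueLaw p M).mgf_sum (fun i => by fun_prop)]
  have h : ∀ i : Fin (p * M), mgf (fun y : Fin (p * M) → ℕ => (y i : ℝ)) (trueLaw p M) t =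
      Real.exp ((1 / p : ℝ) * (Real.exp t - 1)) := by
    intro i
    have h1 : (trueLaw p M).map (Function.eval i) = poissonMeasure (1 / (p : ℝ)).toNNReal :=
      (measurePreserving_eval (fun _ => poissonMeasure (1 / (p : ℝ)).toNNReal) i).map_eq
    rw [← Real.coe_toNNReal (1 / p : ℝ) (by positivity), ← mgf_poissonMeasure, ← h1, mgf, mgf,
      integral_map (measurable_pi_apply i).aemeasurable .of_discrete]
  simp_rw [h]
  rw [Finset.prod_const, card_block, ← Real.exp_nat_mul]
  congr 1
  ring

/-- Chernoff's inequality for a block sum, which has a Poisson distribution of mean `M / p`. -/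
lemma trueLaw_blockSum_deviation_le (p M : ℕ) (j : Fin p) {δ : ℝ} (hδ : 0 < δ) (hδ1 : δ ≤ 1) :
    (trueLaw p M).real {y | δ * (M / p : ℝ) ≤ |(blockSum p M y j : ℝ) - M / p|} ≤
      2 * Real.exp (-((M / p : ℝ) * δ ^ 2 / 4)) := by
  set l : ℝ := M / p with hl
  have hl0 : 0 ≤ l := by positivity
  have key : ∀ t : ℝ, |t| ≤ 1 → Real.exp t - 1 - t ≤ t ^ 2 := fun t ht =>
    (le_abs_self _).trans (Real.abs_exp_sub_one_sub_id_le ht)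
  have hsub : {y | δ * l ≤ |(blockSum p M y j : ℝ) - l|} ⊆
      {y | l + δ * l ≤ (blockSum p M y j : ℝ)} ∪ {y | (blockSum p M y j : ℝ) ≤ l - δ * l} := by
    intro y hy
    rcases le_abs.1 (show δ * l ≤ |(blockSum p M y j : ℝ) - l| from hy) with h | h
    · left
      show l + δ * l ≤ _
      linarith
    · right
      show _ ≤ l - δ * l
      linarith
  have h1 := measure_ge_le_exp_mul_mgf (μ := trueLaw p M) (X := fun y => (blockSum p M y j : ℝ))
    (l + δ * l) (t := δ / 2) (by positivity) (integrable_exp_mul_blockSum p M j _)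
  have h2 := measure_le_le_exp_mul_mgf (μ := trueLaw p M) (X := fun y => (blockSum p M y j : ℝ))
    (l - δ * l) (t := -(δ / 2)) (by linarith) (integrable_exp_mul_blockSum p M j _)
  rw [mgf_blockSum, ← Real.exp_add, ← hl] at h1 h2
  have k1 := mul_le_mul_of_nonneg_left
    (key (δ / 2) (by rw [abs_of_pos (by positivity)]; linarith)) hl0
  have k2 := mul_le_mul_of_nonneg_left
    (key (-(δ / 2)) (by rw [abs_neg, abs_of_pos (by positivity)]; linarith)) hl0
  calc _ ≤ _ := measureReal_mono hsub
    _ ≤ _ := measureReal_union_le _ _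
    _ ≤ _ := add_le_add h1 h2
    _ ≤ Real.exp (-(l * δ ^ 2 / 4)) + Real.exp (-(l * δ ^ 2 / 4)) := by
        gcongr
        · nlinarith
        · nlinarith
    _ = _ := by ring

/-- The data for which all block sums are within the factor `1 ± δ` of their mean. -/
def goodEvent (p M : ℕ) (δ : ℝ) : Set (Fin (p * M) → ℕ) :=
  {y | ∀ j, |(blockSum p M y j : ℝ) - M / p| < δ * (M / p : ℝ)}

lemma trueLaw_compl_goodEvent_le (p M : ℕ) {δ : ℝ} (hδ : 0 < δ) (hδ1 : δ ≤ 1) :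
    (trueLaw p M).real (goodEvent p M δ)ᶜ ≤ p * (2 * Real.exp (-((M / p : ℝ) * δ ^ 2 / 4))) := by
  have h : (goodEvent p M δ)ᶜ =
      ⋃ j, {y | δ * (M / p : ℝ) ≤ |(blockSum p M y j : ℝ) - M / p|} := by
    ext y
    simp [goodEvent]
  rw [h]
  refine (measureReal_iUnion_fintype_le _).trans ?_
  refine (Finset.sum_le_sum fun j _ => trueLaw_blockSum_deviation_le p M j hδ hδ1).trans ?_
  simp

/-! ### Convergence of the centred characteristic functions -/

/-- The leading term of the posterior mean of `√(n / p) * (θ - θ̃)`. The first summand comes from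
the logarithms of the intensities, the second from the prior. -/
def posteriorBias (p M : ℕ) (μ : ℝ) (y : Fin (p * M) → ℕ) : ℝ :=
  Real.sqrt M / (2 * p) * ∑ j, 1 / (blockSum p M y j : ℝ) -
    Real.sqrt M * Real.log (1 + 1 / (μ * M))

lemma charFun_scaledPosterior_mul {p M : ℕ} {μ : ℝ} (hp : 0 < p) (hM : 0 < M) (hμ : 0 < μ)
    {y : Fin (p * M) → ℕ} (hy : ∀ j, 0 < blockSum p M y j) (t : ℝ) :
    charFun (scaledPosterior p M μ y) t * Complex.exp (-(t * posteriorBias p M μ y * Complex.I)) =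
      (∏ j, gammaRatioError (blockSum p M y j) (t * Real.sqrt M / p)) *
        Complex.exp (-((t * Real.sqrt M / p) ^ 2 / 2 * ∑ j, 1 / (blockSum p M y j : ℝ) : ℝ)) := by
  have hpC : (p : ℂ) ≠ 0 := by exact_mod_cast hp.ne'
  rw [charFun_scaledPosterior hp hM hμ hy]
  simp_rw [gammaRatioError]
  rw [Finset.prod_mul_distrib, ← Complex.exp_sum, mul_assoc, mul_assoc (∏ j, _), ← Complex.exp_add,
    ← Complex.exp_add]
  congr 2
  have h : ∀ j, -(((t * Real.sqrt M / p : ℝ) * Complex.I - ((t * Real.sqrt M / p : ℝ) : ℂ) ^ 2) /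
      (2 * (blockSum p M y j : ℂ))) = -(((t * Real.sqrt M / p : ℝ) * Complex.I -
        ((t * Real.sqrt M / p : ℝ) : ℂ) ^ 2) / 2) * ((1 / (blockSum p M y j : ℝ) : ℝ) : ℂ) := by
    intro j
    push_cast
    rw [neg_mul, div_mul_div_comm, mul_one]
  simp_rw [h]
  rw [← Finset.mul_sum, ← Complex.ofReal_sum, posteriorBias]
  generalize ∑ j, 1 / (blockSum p M y j : ℝ) = S
  generalize Real.log (1 + 1 / (μ * M)) = l
  push_cast
  field_simp
  ring

lemma half_mean_lt_blockSum {p M : ℕ} {δ : ℝ} (hl : 0 < (M / p : ℝ)) (hδ : δ ≤ 1 / 2)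
    {y : Fin (p * M) → ℕ} (hy : y ∈ goodEvent p M δ) (j : Fin p) :
    (M / p : ℝ) / 2 < blockSum p M y j := by
  have h := (abs_lt.1 (hy j)).1
  nlinarith

lemma abs_average_sub_one_le {p M : ℕ} {δ : ℝ} (hp : 0 < p) (hl : 0 < (M / p : ℝ))
    (hδ : δ ≤ 1 / 2) {y : Fin (p * M) → ℕ} (hy : y ∈ goodEvent p M δ) :
    |(M / p : ℝ) / p * ∑ j, 1 / (blockSum p M y j : ℝ) - 1| ≤ 2 * δ := by
  have hp' : (0 : ℝ) < p := by exact_mod_cast hp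
  set l : ℝ := M / p with hl'
  have h1 : l / p * ∑ j, 1 / (blockSum p M y j : ℝ) - 1 =
      1 / p * ∑ j, (l - blockSum p M y j) / (blockSum p M y j : ℝ) := by
    have : ∀ j, (l - blockSum p M y j) / (blockSum p M y j : ℝ) =
        l * (1 / (blockSum p M y j : ℝ)) - 1 := by
      intro j
      have hj := half_mean_lt_blockSum hl hδ hy j
      have : (blockSum p M y j : ℝ) ≠ 0 := by
        rw [← hl'] at hj
        linarith
      field_simp
    simp_rw [this]
    rw [Finset.sum_sub_distrib, ← Finset.mul_sum]
    simp
    field_simp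
  have h2 : ∀ j, |(l - blockSum p M y j) / (blockSum p M y j : ℝ)| ≤ 2 * δ := by
    intro j
    have hj := half_mean_lt_blockSum hl hδ hy j
    have hd := hy j
    rw [← hl'] at hj hd
    have hZ : (0 : ℝ) < blockSum p M y j := by linarith
    rw [abs_div, abs_of_pos hZ, abs_sub_comm, div_le_iff₀ hZ]
    have hδ0 : 0 < δ := by
      have := (abs_nonneg _).trans_lt hd
      exact (pos_iff_pos_of_mul_pos this).2 hl
    nlinarith
  rw [h1, abs_mul, abs_of_pos (by positivity)]
  calc 1 / (p : ℝ) * |∑ j, (l - blockSum p M y j) / (blockSum p M y j : ℝ)|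
      ≤ 1 / (p : ℝ) * ∑ _j : Fin p, 2 * δ := by
        gcongr
        exact (Finset.abs_sum_le_sum_abs _ _).trans (Finset.sum_le_sum fun j _ => h2 j)
    _ = 2 * δ := by
        simp
        field_simp

/-- On the good events the harmonic mean of the block sums is asymptotic to `M / p`. -/
lemma tendsto_average {p M : ℕ → ℕ} {δ : ℕ → ℝ} (hM : ∀ k, 0 < M k)
    (hp : Tendsto p atTop atTop) (hδ : Tendsto δ atTop (𝓝 0)) (y : ∀ k, Fin (p k * M k) → ℕ)
    (hy : ∀ᶠ k in atTop, y k ∈ goodEvent (p k) (M k) (δ k)) :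
    Tendsto (fun k => (M k / p k : ℝ) / p k *
      ∑ j, 1 / (blockSum (p k) (M k) (y k) j : ℝ)) atTop (𝓝 1) := by
  rw [tendsto_iff_norm_sub_tendsto_zero]
  have h2 := hδ.const_mul 2
  rw [mul_zero] at h2
  refine squeeze_zero' (Eventually.of_forall fun k => norm_nonneg _) ?_ h2
  filter_upwards [hp.eventually_ge_atTop 1, hy,
    hδ.eventually_le_const (show (0 : ℝ) < 1 / 2 by norm_num)] with k hk hyk hδk
  have hp0 : (0 : ℝ) < p k := by exact_mod_cast hk
  have hM0 : (0 : ℝ) < M k := by exact_mod_cast hM k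
  exact abs_average_sub_one_le hk (by positivity) hδk hyk

lemma norm_prod_gammaRatioError_sub_one_le {ι : Type*} [Fintype ι] (z : ι → ℕ) {l s : ℝ}
    (hl : 0 < l) (hz : ∀ j, l / 2 < z j) (hs : |s| ≤ l / 4) {x : ℝ}
    (hx : Fintype.card ι * (12 * (|s| + |s| ^ 3) / l ^ 2) = x) :
    ‖∏ j, gammaRatioError (z j) s - 1‖ ≤ Real.exp (x * Real.exp x) - 1 := by
  rcases isEmpty_or_nonempty ι with hι | hι
  · simp [← hx]
  have hc : (1 : ℝ) ≤ Fintype.card ι := by exact_mod_cast Fintype.card_pos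
  have h := Finset.univ.norm_prod_one_add_sub_one_le fun j => gammaRatioError (z j) s - 1
  simp only [add_sub_cancel] at h
  refine h.trans ?_
  gcongr
  set b := 12 * (|s| + |s| ^ 3) / l ^ 2 with hb
  have hb0 : 0 ≤ b := by positivity
  have hbx : b ≤ x := by
    rw [← hx]
    exact le_mul_of_one_le_left hb0 hc
  have h1 : ∀ j, ‖gammaRatioError (z j) s - 1‖ ≤ b * Real.exp x := by
    intro j
    have hzj : (0 : ℝ) < z j := lt_trans (by positivity) (hz j)
    have h2 : 3 * (|s| + |s| ^ 3) / (z j : ℝ) ^ 2 ≤ b := by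
      have h3 : b = 3 * (|s| + |s| ^ 3) / (l / 2) ^ 2 := by
        rw [hb]
        field_simp
        ring
      rw [h3]
      have := (hz j).le
      gcongr
    refine (norm_gammaRatioError_sub_one_le (by exact_mod_cast hzj) (by linarith [hz j])).trans ?_
    gcongr
    exact h2.trans hbx
  calc ∑ j, ‖gammaRatioError (z j) s - 1‖ ≤ ∑ _j : ι, b * Real.exp x :=
        Finset.sum_le_sum fun j _ => h1 j
    _ = x * Real.exp x := by
        rw [Finset.sum_const, Finset.card_univ, nsmul_eq_mul, ← hx]
        ring

/-- The characteristic functions, centred at `posteriorBias`, converge along every sequence of data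
from the good events. The assumption on `p / (√(M / p)) ^ 3` makes the sum over the blocks of the
errors in Stirling's formula vanish. -/
lemma tendsto_charFun_scaledPosterior {p M : ℕ → ℕ} {μ δ : ℕ → ℝ} (hM : ∀ k, 0 < M k)
    (hp : Tendsto p atTop atTop) (hμ : ∀ k, 0 < μ k)
    (hb : Tendsto (fun k => Real.sqrt (M k / p k)) atTop atTop)
    (hq : Tendsto (fun k => (p k : ℝ) / Real.sqrt (M k / p k) ^ 3) atTop (𝓝 0))
    (hδ : Tendsto δ atTop (𝓝 0)) (y : ∀ k, Fin (p k * M k) → ℕ)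
    (hy : ∀ᶠ k in atTop, y k ∈ goodEvent (p k) (M k) (δ k)) (t : ℝ) :
    Tendsto (fun k => charFun (scaledPosterior (p k) (M k) (μ k) (y k)) t *
      Complex.exp (-(t * posteriorBias (p k) (M k) (μ k) (y k) * Complex.I))) atTop
      (𝓝 (Complex.exp (-(t ^ 2 / 2 : ℝ)))) := by
  set a : ℕ → ℝ := fun k => Real.sqrt (p k) with ha
  set b : ℕ → ℝ := fun k => Real.sqrt (M k / p k) with hbdef
  have hpR : Tendsto (fun k => (p k : ℝ)) atTop atTop := tendsto_natCast_atTop_atTop.comp hp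
  have hat : Tendsto a atTop atTop := Real.tendsto_sqrt_atTop.comp hpR
  have hp1 : ∀ᶠ k in atTop, 1 ≤ p k := hp.eventually_ge_atTop 1
  have hδ2 : ∀ᶠ k in atTop, δ k ≤ 1 / 2 := hδ.eventually_le_const (by norm_num)
  set x : ℕ → ℝ := fun k => 12 * (|t| * (a k / b k ^ 3) + |t| ^ 3 * (1 / (a k * b k))) with hx
  have hab : Tendsto (fun k => 1 / (a k * b k)) atTop (𝓝 0) := by
    simp only [one_div]
    exact tendsto_inv_atTop_zero.comp (hat.atTop_mul_atTop₀ hb)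
  have hab3 : Tendsto (fun k => a k / b k ^ 3) atTop (𝓝 0) := by
    refine squeeze_zero' (Eventually.of_forall fun k => by positivity) ?_ hq
    filter_upwards [hp1] with k hk
    have h1 : (1 : ℝ) ≤ p k := by exact_mod_cast hk
    gcongr
    exact Real.sqrt_le_self_iff.2 (Or.inr h1)
  have hx0 : Tendsto x atTop (𝓝 0) := by
    have := ((hab3.const_mul (|t|)).add (hab.const_mul (|t| ^ 3))).const_mul 12
    simpa only [mul_zero, add_zero] using this
  -- `M = (a b) ^ 2` and `M / p = b ^ 2`, so that the scale `t √M / p` is `t b / a`.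
  have hbasic : ∀ᶠ k in atTop, 0 < p k ∧ 0 < a k ∧ 0 < b k ∧ (p k : ℝ) = a k ^ 2 ∧
      (M k / p k : ℝ) = b k ^ 2 ∧ t * Real.sqrt (M k) / p k = t * b k / a k := by
    filter_upwards [hp1] with k hk
    have hp0 : (0 : ℝ) < p k := by exact_mod_cast hk
    have hM0 : (0 : ℝ) < M k := by exact_mod_cast hM k
    have ha0 : 0 < a k := Real.sqrt_pos.2 hp0
    have hb0 : 0 < b k := Real.sqrt_pos.2 (by positivity)
    have hpa : (p k : ℝ) = a k ^ 2 := (Real.sq_sqrt hp0.le).symm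
    have hMb : (M k / p k : ℝ) = b k ^ 2 := (Real.sq_sqrt (by positivity)).symm
    refine ⟨hk, ha0, hb0, hpa, hMb, ?_⟩
    have hMs : Real.sqrt (M k) = b k * a k := by
      rw [hbdef, ha]
      simp only
      rw [← Real.sqrt_mul (by positivity), div_mul_cancel₀ _ hp0.ne']
    rw [hMs, hpa]
    field_simp
  have hsmall : ∀ᶠ k in atTop, |t| * (1 / (a k * b k)) ≤ 1 / 4 := by
    have := hab.const_mul (|t|)
    rw [mul_zero] at this
    exact this.eventually_le_const (by norm_num)
  have hprod : Tendsto (fun k => ∏ j, gammaRatioError (blockSum (p k) (M k) (y k) j)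
      (t * Real.sqrt (M k) / p k)) atTop (𝓝 1) := by
    rw [tendsto_iff_norm_sub_tendsto_zero]
    have hlim : Tendsto (fun k => Real.exp (x k * Real.exp (x k)) - 1) atTop (𝓝 0) := by
      have := ((hx0.mul hx0.rexp).rexp).sub_const 1
      simpa using this
    refine squeeze_zero' (Eventually.of_forall fun k => norm_nonneg _) ?_ hlim
    filter_upwards [hbasic, hsmall, hy, hδ2] with k ⟨hk, ha0, hb0, hpa, hMb, hs⟩ hsm hyk hδk
    have hl : (0 : ℝ) < M k / p k := by rw [hMb]; positivity
    refine norm_prod_gammaRatioError_sub_one_le _ hl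
      (fun j => half_mean_lt_blockSum hl hδk hyk j) ?_ ?_
    · rw [hs, hMb, abs_div, abs_mul, abs_of_pos ha0, abs_of_pos hb0]
      calc |t| * b k / a k = |t| * (1 / (a k * b k)) * b k ^ 2 := by field_simp
        _ ≤ 1 / 4 * b k ^ 2 := by gcongr
        _ = b k ^ 2 / 4 := by ring
    · rw [hs, hMb, abs_div, abs_mul, abs_of_pos ha0, abs_of_pos hb0, Fintype.card_fin, hpa, hx]
      field_simp
  have hvar : Tendsto (fun k => (t * Real.sqrt (M k) / p k) ^ 2 / 2 *
      ∑ j, 1 / (blockSum (p k) (M k) (y k) j : ℝ)) atTop (𝓝 (t ^ 2 / 2)) := by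
    have h3 := (tendsto_average hM hp hδ y hy).const_mul (t ^ 2 / 2)
    rw [mul_one] at h3
    refine h3.congr' ?_
    filter_upwards [hbasic] with k ⟨hk, ha0, hb0, hpa, hMb, hs⟩
    rw [hs, hMb, ← mul_assoc]
    congr 1
    rw [hpa]
    field_simp
  have hmain := hprod.mul ((Complex.continuous_ofReal.tendsto _).comp hvar).neg.cexp
  rw [one_mul] at hmain
  refine hmain.congr' ?_
  filter_upwards [hbasic, hy, hδ2] with k ⟨hk, ha0, hb0, hpa, hMb, hs⟩ hyk hδk
  have hl : (0 : ℝ) < M k / p k := by rw [hMb]; positivity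
  rw [charFun_scaledPosterior_mul hk (hM k) (hμ k) fun j => ?_]
  · rfl
  · have := half_mean_lt_blockSum hl hδk hyk j
    exact_mod_cast (lt_trans (by positivity) this : (0 : ℝ) < blockSum (p k) (M k) (y k) j)

/-! ### From characteristic functions to convergence in probability -/

lemma tendsto_integral_of_tendsto_charFun_mul {Q : ℕ → Measure ℝ}
    [∀ k, IsProbabilityMeasure (Q k)] {m : ℕ → ℝ} {c : ℝ}
    (hQ : ∀ t : ℝ, Tendsto (fun k => charFun (Q k) t * Complex.exp (-(t * m k * Complex.I))) atTop
      (𝓝 (Complex.exp (-(t ^ 2 / 2 : ℝ)))))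
    (hm : Tendsto m atTop (𝓝 c)) (f : BoundedContinuousFunction ℝ ℝ) :
    Tendsto (fun k => ∫ x, f x ∂(Q k)) atTop (𝓝 (∫ x, f x ∂(gaussianReal c 1))) := by
  let ν : ProbabilityMeasure ℝ := ⟨gaussianReal c 1, inferInstance⟩
  let R : ℕ → ProbabilityMeasure ℝ := fun k => ⟨Q k, inferInstance⟩
  have h : Tendsto R atTop (𝓝 ν) := by
    refine ProbabilityMeasure.tendsto_of_tendsto_charFun fun t => ?_
    have h1 : Tendsto (fun k => Complex.exp (t * m k * Complex.I)) atTop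
        (𝓝 (Complex.exp (t * c * Complex.I))) :=
      ((((Complex.continuous_ofReal.tendsto c).comp hm).const_mul (t : ℂ)).mul_const
        Complex.I).cexp
    have h2 := (hQ t).mul h1
    have h3 : charFun (ν : Measure ℝ) t =
        Complex.exp (-(t ^ 2 / 2 : ℝ)) * Complex.exp (t * c * Complex.I) := by
      show charFun (gaussianReal c 1) t = _
      rw [charFun_gaussianReal, ← Complex.exp_add]
      congr 1
      push_cast
      ring
    rw [h3]
    refine h2.congr fun k => ?_
    rw [mul_assoc, ← Complex.exp_add, neg_add_cancel, Complex.exp_zero, mul_one]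
    rfl
  exact ProbabilityMeasure.tendsto_iff_forall_integral_tendsto.1 h f

lemma tendsto_real_Ioi_of_tendsto_charFun_mul {Q : ℕ → Measure ℝ}
    [∀ k, IsProbabilityMeasure (Q k)] {m : ℕ → ℝ}
    (hQ : ∀ t : ℝ, Tendsto (fun k => charFun (Q k) t * Complex.exp (-(t * m k * Complex.I))) atTop
      (𝓝 (Complex.exp (-(t ^ 2 / 2 : ℝ)))))
    (hm : Tendsto m atTop atTop) (K : ℝ) :
    Tendsto (fun k => (Q k).real (Set.Ioi K)) atTop (𝓝 1) := by
  have hmeas : ∀ k, Measurable fun x : ℝ => x - m k := fun k => measurable_id.sub_const _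
  have hprob : ∀ k, IsProbabilityMeasure ((Q k).map fun x => x - m k) := fun k =>
    Measure.isProbabilityMeasure_map (hmeas k).aemeasurable
  let ν : ProbabilityMeasure ℝ := ⟨gaussianReal 0 1, inferInstance⟩
  let R : ℕ → ProbabilityMeasure ℝ := fun k => ⟨(Q k).map fun x => x - m k, hprob k⟩
  have h : Tendsto R atTop (𝓝 ν) := by
    refine ProbabilityMeasure.tendsto_of_tendsto_charFun fun t => ?_
    have h3 : charFun (ν : Measure ℝ) t = Complex.exp (-(t ^ 2 / 2 : ℝ)) := by
      show charFun (gaussianReal 0 1) t = _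
      rw [charFun_gaussianReal]
      congr 1
      push_cast
      ring
    rw [h3]
    refine (hQ t).congr fun k => ?_
    show _ = charFun ((Q k).map fun x => x - m k) t
    rw [charFun_apply_real, charFun_apply_real, integral_map (hmeas k).aemeasurable (by fun_prop),
      ← integral_mul_const]
    refine integral_congr_ae (Eventually.of_forall fun x => ?_)
    simp only
    rw [← Complex.exp_add]
    congr 1
    push_cast
    ring
  rw [tendsto_order]
  refine ⟨fun c hc => ?_, fun c hc => Eventually.of_forall fun k => measureReal_le_one.trans_lt hc⟩
  obtain ⟨N, hN⟩ : ∃ N : ℕ, ENNReal.ofReal c < gaussianReal 0 1 (Set.Ioi (-(N : ℝ))) := by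
    have h1 : Monotone fun N : ℕ => Set.Ioi (-(N : ℝ)) := fun a b hab =>
      Set.Ioi_subset_Ioi (neg_le_neg (by exact_mod_cast hab))
    have h2 := tendsto_measure_iUnion_atTop (μ := gaussianReal 0 1) h1
    have h3 : ⋃ N : ℕ, Set.Ioi (-(N : ℝ)) = Set.univ := by
      refine Set.eq_univ_of_forall fun x => ?_
      obtain ⟨N, hN⟩ := exists_nat_gt (-x)
      exact Set.mem_iUnion.2 ⟨N, by show -(N : ℝ) < x; linarith⟩
    rw [h3, measure_univ] at h2
    exact (h2.eventually_const_lt (ENNReal.ofReal_lt_one.2 hc)).exists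
  have h4 := eventually_lt_of_lt_liminf
    (hN.trans_le (ProbabilityMeasure.le_liminf_measure_open_of_tendsto h isOpen_Ioi))
  filter_upwards [h4, hm.eventually_ge_atTop (K + N)] with k hk1 hk2
  have h5 : ENNReal.ofReal c < Q k (Set.Ioi K) := by
    refine hk1.trans_le ?_
    show ((Q k).map fun x => x - m k) (Set.Ioi (-(N : ℝ))) ≤ _
    rw [Measure.map_apply (hmeas k) measurableSet_Ioi]
    refine measure_mono fun x hx => ?_
    have : -(N : ℝ) < x - m k := hx
    show K < x
    linarith
  by_contra hle
  rw [← ofReal_measureReal] at h5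
  exact absurd h5 (not_lt.2 (ENNReal.ofReal_le_ofReal (not_lt.1 hle)))

/-- Convergence along every choice of points from events whose probability tends to one implies
convergence in probability. -/
lemma tendsto_measure_abs_sub_ge {Ω : ℕ → Type} [∀ k, MeasurableSpace (Ω k)]
    (P : ∀ k, Measure (Ω k)) [∀ k, IsProbabilityMeasure (P k)] (A : ∀ k, Set (Ω k))
    (hA : Tendsto (fun k => P k (A k)ᶜ) atTop (𝓝 0)) (g : ∀ k, Ω k → ℝ) (c : ℝ)
    (h : ∀ y : ∀ k, Ω k, (∀ᶠ k in atTop, y k ∈ A k) →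
      Tendsto (fun k => g k (y k)) atTop (𝓝 c)) {ε : ℝ} (hε : 0 < ε) :
    Tendsto (fun k => P k {ω | ε ≤ |g k ω - c|}) atTop (𝓝 0) := by
  have hne : ∀ k, Nonempty (Ω k) := fun k => (P k).nonempty_of_neZero
  have hAne : ∀ᶠ k in atTop, (A k).Nonempty := by
    filter_upwards [hA.eventually_lt_const one_pos] with k hk
    by_contra h0
    rw [Set.not_nonempty_iff_eq_empty.1 h0, Set.compl_empty, measure_univ] at hk
    exact lt_irrefl _ hk
  -- Choose a point of the event where the deviation is large, if there is one.
  have hchoice : ∀ k, ∃ ω : Ω k, ((A k).Nonempty → ω ∈ A k) ∧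
      ((∃ ω' ∈ A k, ε ≤ |g k ω' - c|) → ε ≤ |g k ω - c|) := by
    intro k
    by_cases h1 : ∃ ω' ∈ A k, ε ≤ |g k ω' - c|
    · obtain ⟨ω, hω, hω'⟩ := h1
      exact ⟨ω, fun _ => hω, fun _ => hω'⟩
    · by_cases h2 : (A k).Nonempty
      · exact ⟨h2.some, fun _ => h2.some_mem, fun h => absurd h h1⟩
      · exact ⟨(hne k).some, fun h => absurd h h2, fun h => absurd h h1⟩
  choose y hyA hyg using hchoice
  have hlim := h y (hAne.mono fun k hk => hyA k hk)
  have hev : ∀ᶠ k in atTop, |g k (y k) - c| < ε := by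
    have := (Metric.tendsto_nhds.1 hlim) ε hε
    simpa only [Real.dist_eq] using this
  refine tendsto_of_tendsto_of_tendsto_of_le_of_le' tendsto_const_nhds hA
    (Eventually.of_forall fun k => zero_le) ?_
  filter_upwards [hev] with k hk
  refine measure_mono fun ω hω hωA => ?_
  exact absurd (hyg k ⟨ω, hωA, hω⟩) (not_le.2 hk)

lemma tendsto_trueLaw_compl_goodEvent {p M : ℕ → ℕ}
    (hb : Tendsto (fun k => Real.sqrt (M k / p k)) atTop atTop)
    (hq : Tendsto (fun k => (p k : ℝ) / Real.sqrt (M k / p k) ^ 3) atTop (𝓝 0)) :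
    Tendsto (fun k => trueLaw (p k) (M k)
      (goodEvent (p k) (M k) (1 / Real.sqrt (Real.sqrt (M k / p k))))ᶜ) atTop (𝓝 0) := by
  have hreal : Tendsto (fun k => (trueLaw (p k) (M k)).real
      (goodEvent (p k) (M k) (1 / Real.sqrt (Real.sqrt (M k / p k))))ᶜ) atTop (𝓝 0) := by
    have h768 := hq.const_mul 768
    rw [mul_zero] at h768
    refine squeeze_zero' (Eventually.of_forall fun k => measureReal_nonneg) ?_ h768
    filter_upwards [hb.eventually_ge_atTop 1] with k hk
    set b := Real.sqrt (M k / p k : ℝ) with hbdef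
    have hb0 : 0 < b := by linarith
    have hl : (M k / p k : ℝ) = b ^ 2 := (Real.sq_sqrt (by positivity)).symm
    have hs1 : 1 ≤ Real.sqrt b := Real.one_le_sqrt.2 hk
    have h := trueLaw_compl_goodEvent_le (p k) (M k) (δ := 1 / Real.sqrt b) (by positivity)
      (by rw [div_le_one (by positivity)]; exact hs1)
    refine h.trans ?_
    have h2 : (M k / p k : ℝ) * (1 / Real.sqrt b) ^ 2 / 4 = b / 4 := by
      rw [hl, div_pow, Real.sq_sqrt hb0.le]
      field_simp
    -- The third order term of the exponential series bounds the exponential by a power of `b`.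
    have h3 : Real.exp (-(b / 4)) ≤ 384 / b ^ 3 := by
      have h4 := Real.pow_div_factorial_le_exp (b / 4) (by positivity) 3
      rw [Real.exp_neg, inv_le_comm₀ (Real.exp_pos _) (by positivity)]
      refine le_trans (le_of_eq ?_) h4
      norm_num [Nat.factorial]
      ring
    rw [h2]
    calc (p k : ℝ) * (2 * Real.exp (-(b / 4))) ≤ p k * (2 * (384 / b ^ 3)) := by gcongr
      _ = 768 * (p k / b ^ 3) := by ring
  have := (ENNReal.tendsto_toReal_iff (fun k => measure_ne_top _ _) ENNReal.zero_ne_top).1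
    (hreal.congr fun k => rfl)
  exact this

/-- The effect of the prior on the centring is negligible. -/
lemma tendsto_sqrt_mul_log {M : ℕ → ℕ} {μ : ℕ → ℝ} (hM : ∀ k, 0 < M k) (hμ : ∀ k, 0 < μ k)
    (h : Tendsto (fun k => μ k * Real.sqrt (M k)) atTop atTop) :
    Tendsto (fun k => Real.sqrt (M k) * Real.log (1 + 1 / (μ k * M k))) atTop (𝓝 0) := by
  refine squeeze_zero (fun k => ?_) (fun k => ?_) (tendsto_inv_atTop_zero.comp h)
  · have := hμ k
    exact mul_nonneg (Real.sqrt_nonneg _)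
      (Real.log_nonneg (by linarith [show (0 : ℝ) ≤ 1 / (μ k * M k) by positivity]))
  · have h1 := hμ k
    have h2 : (0 : ℝ) < M k := by exact_mod_cast hM k
    have h3 : Real.log (1 + 1 / (μ k * M k)) ≤ 1 / (μ k * M k) := by
      have := Real.log_le_sub_one_of_pos (x := 1 + 1 / (μ k * M k)) (by positivity)
      linarith
    have h4 : 0 < Real.sqrt (M k) := Real.sqrt_pos.2 h2
    calc Real.sqrt (M k) * Real.log (1 + 1 / (μ k * M k))
        ≤ Real.sqrt (M k) * (1 / (μ k * M k)) := by gcongr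
      _ = Real.sqrt (M k) * (1 / (μ k * Real.sqrt (M k) ^ 2)) := by rw [Real.sq_sqrt h2.le]
      _ = (μ k * Real.sqrt (M k))⁻¹ := by field_simp

/-- Up to the effect of the prior, the centring is `√(p ^ 2 / M) / 2` times an average that tends
to one. -/
lemma exists_posteriorBias_eq {p M : ℕ → ℕ} {μ δ : ℕ → ℝ} (hM : ∀ k, 0 < M k)
    (hp : Tendsto p atTop atTop) (hμ : ∀ k, 0 < μ k)
    (hμM : Tendsto (fun k => μ k * Real.sqrt (M k)) atTop atTop)
    (hδ : Tendsto δ atTop (𝓝 0)) (y : ∀ k, Fin (p k * M k) → ℕ)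
    (hy : ∀ᶠ k in atTop, y k ∈ goodEvent (p k) (M k) (δ k)) :
    ∃ A e : ℕ → ℝ, Tendsto A atTop (𝓝 (1 / 2)) ∧ Tendsto e atTop (𝓝 0) ∧
      ∀ᶠ k in atTop, Real.sqrt ((p k : ℝ) ^ 2 / M k) * A k - e k =
        posteriorBias (p k) (M k) (μ k) (y k) := by
  have hA := (tendsto_average hM hp hδ y hy).mul_const (1 / 2)
  rw [one_mul] at hA
  refine ⟨_, _, hA, tendsto_sqrt_mul_log hM hμ hμM, ?_⟩
  filter_upwards [hp.eventually_ge_atTop 1] with k hk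
  have hp0 : (0 : ℝ) < p k := by exact_mod_cast hk
  have hM0 : (0 : ℝ) < M k := by exact_mod_cast hM k
  have hs : 0 < Real.sqrt (M k) := Real.sqrt_pos.2 hM0
  have hMs : (M k : ℝ) = Real.sqrt (M k) ^ 2 := (Real.sq_sqrt hM0.le).symm
  rw [posteriorBias, Real.sqrt_div (by positivity), Real.sqrt_sq hp0.le]
  congr 1
  generalize ∑ j, 1 / (blockSum (p k) (M k) (y k) j : ℝ) = S
  generalize Real.sqrt (M k) = r at hs hMs
  rw [hMs]
  field_simp

/-! ### The asymptotic regimes -/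

lemma tendstoWeaklyInProb_scaledPosterior {p M : ℕ → ℕ} {μ : ℕ → ℝ} (hM : ∀ k, 0 < M k)
    (hp : Tendsto p atTop atTop) (hμ : ∀ k, 0 < μ k)
    (hμM : Tendsto (fun k => μ k * Real.sqrt (M k)) atTop atTop)
    (hb : Tendsto (fun k => Real.sqrt (M k / p k)) atTop atTop)
    (hq : Tendsto (fun k => (p k : ℝ) / Real.sqrt (M k / p k) ^ 3) atTop (𝓝 0)) {c : ℝ}
    (hc : Tendsto (fun k => Real.sqrt ((p k : ℝ) ^ 2 / M k)) atTop (𝓝 c)) :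
    TendstoWeaklyInProb (fun k => trueLaw (p k) (M k))
      (fun k => scaledPosterior (p k) (M k) (μ k)) (gaussianReal (c / 2) 1) := by
  intro f ε hε
  refine tendsto_measure_abs_sub_ge _ _ (tendsto_trueLaw_compl_goodEvent hb hq)
    (fun k y => ∫ x, f x ∂(scaledPosterior (p k) (M k) (μ k) y)) _ (fun y hy => ?_) hε
  have hδ : Tendsto (fun k => 1 / Real.sqrt (Real.sqrt (M k / p k))) atTop (𝓝 0) := by
    simp only [one_div]
    exact tendsto_inv_atTop_zero.comp (Real.tendsto_sqrt_atTop.comp hb)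
  have hprob := fun k => isProbabilityMeasure_scaledPosterior (hμ k) (y k)
  refine tendsto_integral_of_tendsto_charFun_mul
    (fun t => tendsto_charFun_scaledPosterior hM hp hμ hb hq hδ y hy t) ?_ f
  obtain ⟨A, e, hA, he, hAe⟩ := exists_posteriorBias_eq hM hp hμ hμM hδ y hy
  have h := (hc.mul hA).sub he
  rw [sub_zero, mul_one_div] at h
  exact h.congr' hAe

lemma tendstoTopInProb_scaledPosterior {p M : ℕ → ℕ} {μ : ℕ → ℝ} (hM : ∀ k, 0 < M k)
    (hp : Tendsto p atTop atTop) (hμ : ∀ k, 0 < μ k)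
    (hμM : Tendsto (fun k => μ k * Real.sqrt (M k)) atTop atTop)
    (hb : Tendsto (fun k => Real.sqrt (M k / p k)) atTop atTop)
    (hq : Tendsto (fun k => (p k : ℝ) / Real.sqrt (M k / p k) ^ 3) atTop (𝓝 0))
    (hc : Tendsto (fun k => Real.sqrt ((p k : ℝ) ^ 2 / M k)) atTop atTop) :
    TendstoTopInProb (fun k => trueLaw (p k) (M k))
      (fun k => scaledPosterior (p k) (M k) (μ k)) := by
  intro K ε hε
  refine tendsto_measure_abs_sub_ge _ _ (tendsto_trueLaw_compl_goodEvent hb hq)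
    (fun k y => (scaledPosterior (p k) (M k) (μ k) y).real (Set.Ioi K)) _ (fun y hy => ?_) hε
  have hδ : Tendsto (fun k => 1 / Real.sqrt (Real.sqrt (M k / p k))) atTop (𝓝 0) := by
    simp only [one_div]
    exact tendsto_inv_atTop_zero.comp (Real.tendsto_sqrt_atTop.comp hb)
  have hprob := fun k => isProbabilityMeasure_scaledPosterior (hμ k) (y k)
  refine tendsto_real_Ioi_of_tendsto_charFun_mul
    (fun t => tendsto_charFun_scaledPosterior hM hp hμ hb hq hδ y hy t) ?_ K
  obtain ⟨A, e, hA, he, hAe⟩ := exists_posteriorBias_eq hM hp hμ hμM hδ y hy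
  have h := (hc.atTop_mul_pos (by norm_num) hA).atTop_add he.neg
  simp only [← sub_eq_add_neg] at h
  exact h.congr' hAe

lemma cube_div_eq {p M : ℕ} (hp : 0 < p) :
    (p : ℝ) ^ 3 / ((p * M : ℕ) : ℝ) = (p : ℝ) ^ 2 / M := by
  have : (p : ℝ) ≠ 0 := by exact_mod_cast hp.ne'
  push_cast
  rw [pow_succ (p : ℝ) 2, mul_comm, mul_div_mul_left _ _ this]

lemma fourth_power_div_eq {p M : ℕ} (hp : 0 < p) (hM : 0 < M) :
    (p : ℝ) ^ 4 / ((p * M : ℕ) : ℝ) ^ (3 / 2 : ℝ) = (p : ℝ) / Real.sqrt (M / p) ^ 3 := by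
  have hp0 : (0 : ℝ) < p := by exact_mod_cast hp
  have hM0 : (0 : ℝ) < M := by exact_mod_cast hM
  have h1 : ((p * M : ℕ) : ℝ) = (p * Real.sqrt (M / p)) ^ 2 := by
    rw [mul_pow, Real.sq_sqrt (by positivity)]
    push_cast
    field_simp
  have hb : 0 < Real.sqrt (M / p : ℝ) := Real.sqrt_pos.2 (by positivity)
  rw [h1, ← Real.rpow_natCast _ 2, ← Real.rpow_mul (by positivity)]
  have h2 : ((2 : ℕ) : ℝ) * (3 / 2) = ((3 : ℕ) : ℝ) := by norm_num
  rw [h2, Real.rpow_natCast]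
  field_simp

/-- If `p ^ 3 / n` stays bounded, then `p ^ 4 / n ^ (3 / 2)`, which is its power `3 / 2` divided by
`√p`, tends to zero. -/
lemma tendsto_div_sqrt_cube {p M : ℕ → ℕ} (hM : ∀ k, 0 < M k) (hp : Tendsto p atTop atTop)
    {c : ℝ} (hc : Tendsto (fun k => Real.sqrt ((p k : ℝ) ^ 2 / M k)) atTop (𝓝 c)) :
    Tendsto (fun k => (p k : ℝ) / Real.sqrt (M k / p k) ^ 3) atTop (𝓝 0) := by
  have hpR : Tendsto (fun k => (p k : ℝ)) atTop atTop := tendsto_natCast_atTop_atTop.comp hp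
  have h := (hc.pow 3).mul (tendsto_inv_atTop_zero.comp (Real.tendsto_sqrt_atTop.comp hpR))
  rw [mul_zero] at h
  refine h.congr' ?_
  filter_upwards [hp.eventually_ge_atTop 1] with k hk
  have hp0 : (0 : ℝ) < p k := by exact_mod_cast hk
  have hM0 : (0 : ℝ) < M k := by exact_mod_cast hM k
  have ha : 0 < Real.sqrt (p k) := Real.sqrt_pos.2 hp0
  have hs : 0 < Real.sqrt (M k) := Real.sqrt_pos.2 hM0
  have hpa : (p k : ℝ) = Real.sqrt (p k) ^ 2 := (Real.sq_sqrt hp0.le).symm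
  simp only [Function.comp]
  rw [Real.sqrt_div (by positivity), Real.sqrt_div (by positivity), Real.sqrt_sq hp0.le]
  generalize Real.sqrt (p k) = a at ha hpa
  rw [hpa]
  field_simp

lemma tendsto_sqrt_mean {p M : ℕ → ℕ} (hM : ∀ k, 0 < M k) (hp : Tendsto p atTop atTop)
    (hq : Tendsto (fun k => (p k : ℝ) / Real.sqrt (M k / p k) ^ 3) atTop (𝓝 0)) :
    Tendsto (fun k => Real.sqrt (M k / p k)) atTop atTop := by
  have hpos : ∀ᶠ k in atTop, (0 : ℝ) < p k ∧ 0 < Real.sqrt (M k / p k : ℝ) := by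
    filter_upwards [hp.eventually_ge_atTop 1] with k hk
    have hp0 : (0 : ℝ) < p k := by exact_mod_cast hk
    have hM0 : (0 : ℝ) < M k := by exact_mod_cast hM k
    exact ⟨hp0, Real.sqrt_pos.2 (by positivity)⟩
  have hpR : Tendsto (fun k => (p k : ℝ)) atTop atTop := tendsto_natCast_atTop_atTop.comp hp
  have h1 : Tendsto (fun k => (p k : ℝ) / Real.sqrt (M k / p k) ^ 3) atTop (𝓝[>] 0) :=
    tendsto_nhdsWithin_iff.2 ⟨hq, hpos.mono fun k hk => div_pos hk.1 (pow_pos hk.2 3)⟩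
  have h3 : Tendsto (fun k => Real.sqrt (M k / p k) ^ 3) atTop atTop := by
    refine (hpR.atTop_mul_atTop₀ (tendsto_inv_nhdsGT_zero.comp h1)).congr' ?_
    filter_upwards [hpos] with k hk
    have := hk.1
    have := hk.2
    simp only [Function.comp]
    field_simp
  refine tendsto_atTop.2 fun C => ?_
  filter_upwards [h3.eventually_gt_atTop (|C| ^ 3)] with k hk
  exact (le_abs_self C).trans (lt_of_pow_lt_pow_left₀ 3 (Real.sqrt_nonneg _) hk).le

end

end PoissonBvM

theorem theorem4p2 (n p M : ℕ → ℕ) (μ : ℕ → ℝ)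
    (hn : ∀ k, n k = p k * M k) (hM : ∀ k, 0 < M k)
    (hp : Tendsto p atTop atTop)
    (hμ_pos : ∀ k, 0 < μ k)
    (hμ : Tendsto (fun k => μ k * Real.sqrt ((n k : ℝ) / (p k : ℝ))) atTop atTop) :
    (Tendsto (fun k => (p k : ℝ) ^ 3 / (n k : ℝ)) atTop (𝓝 0) →
      PoissonBvM.TendstoWeaklyInProb (fun k => PoissonBvM.trueLaw (p k) (M k))
        (fun k => PoissonBvM.scaledPosterior (p k) (M k) (μ k)) (gaussianReal 0 1)) ∧
    (∀ β : ℝ, 0 < β → (∀ k, (p k : ℝ) ^ 3 / (n k : ℝ) = β ^ 2) →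
      PoissonBvM.TendstoWeaklyInProb (fun k => PoissonBvM.trueLaw (p k) (M k))
        (fun k => PoissonBvM.scaledPosterior (p k) (M k) (μ k)) (gaussianReal (β / 2) 1)) ∧
    (Tendsto (fun k => (p k : ℝ) ^ 3 / (n k : ℝ)) atTop atTop →
      Tendsto (fun k => (p k : ℝ) ^ 4 / (n k : ℝ) ^ (3 / 2 : ℝ)) atTop (𝓝 0) →
      PoissonBvM.TendstoTopInProb (fun k => PoissonBvM.trueLaw (p k) (M k))
        (fun k => PoissonBvM.scaledPosterior (p k) (M k) (μ k))) := by
  obtain rfl : n = fun k => p k * M k := funext hn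
  have hp1 : ∀ᶠ k in atTop, 0 < p k := hp.eventually_gt_atTop 0
  have hμM : Tendsto (fun k => μ k * Real.sqrt (M k)) atTop atTop := by
    refine hμ.congr' ?_
    filter_upwards [hp1] with k hk
    have : (p k : ℝ) ≠ 0 := by exact_mod_cast hk.ne'
    push_cast
    rw [mul_div_cancel_left₀ _ this]
  have hweak : ∀ c : ℝ, Tendsto (fun k => Real.sqrt ((p k : ℝ) ^ 2 / M k)) atTop (𝓝 c) →
      PoissonBvM.TendstoWeaklyInProb (fun k => PoissonBvM.trueLaw (p k) (M k))
        (fun k => PoissonBvM.scaledPosterior (p k) (M k) (μ k)) (gaussianReal (c / 2) 1) := by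
    intro c hc
    have hq := PoissonBvM.tendsto_div_sqrt_cube hM hp hc
    exact PoissonBvM.tendstoWeaklyInProb_scaledPosterior hM hp hμ_pos hμM
      (PoissonBvM.tendsto_sqrt_mean hM hp hq) hq hc
  refine ⟨fun h => ?_, fun β hβ h => ?_, fun h h4 => ?_⟩
  · have h1 : Tendsto (fun k => (p k : ℝ) ^ 2 / M k) atTop (𝓝 0) :=
      h.congr' (hp1.mono fun k hk => PoissonBvM.cube_div_eq hk)
    have h2 := hweak 0 (by simpa using h1.sqrt)
    rwa [zero_div] at h2
  · refine hweak β (tendsto_const_nhds.congr' (hp1.mono fun k hk => ?_))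
    have h1 := h k
    simp only [PoissonBvM.cube_div_eq hk] at h1
    simp only
    rw [h1, Real.sqrt_sq hβ.le]
  · have hq : Tendsto (fun k => (p k : ℝ) / Real.sqrt (M k / p k) ^ 3) atTop (𝓝 0) :=
      h4.congr' (hp1.mono fun k hk => PoissonBvM.fourth_power_div_eq hk (hM k))
    exact PoissonBvM.tendstoTopInProb_scaledPosterior hM hp hμ_pos hμM
      (PoissonBvM.tendsto_sqrt_mean hM hp hq) hq
      (Real.tendsto_sqrt_atTop.comp
        (h.congr' (hp1.mono fun k hk => PoissonBvM.cube_div_eq hk)))
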